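/- All Hilbert spaces are finite dimensional and all index sets are finite; there is at least one setting $x$. An assemblage is a family of operators $\sigma_{a|x}\ge 0$ on $\mathcal H_B$ such that $\sum_a\sigma_{a|x}=\rho_B$ is independent of $x$ and $\mathrm{tr}\,\rho_B=1$ (equivalently, $\sigma_{a|x}=\mathrm{tr}_A[\rho_{AB}(E_{a|x}\otimes 1)]$ for a state $\rho_{AB}$ and POVMs $\{E_{a|x}\}_a$). It is unsteerable, written $\{\sigma_{a|x}\}\in\mathsf{LHS}$, if $\sigma_{a|x}=\sum_\lambda p(\lambda)p(a|x,\lambda)\sigma_\lambda$ for probability distributions $p(\cdot)$, $p(\cdot|x,\lambda)$ and density matrices $\sigma_\lambda$. Let $\{\omega_y\}$ be a finite tomographically complete set of density matrices on $\mathcal H_{B_0}$, $\dim\mathcal H_{B_0}=\dim\mathcal H_B$ (their real span contains all Hermitian operators). For real coefficients $\beta=\{\beta_{a,1}^{x,y}\}$ and an effect $0\le E_1\le 1$ on $\mathcal H_B\otimes\mathcal H_{B_0}$ put $$I_{E_1}(\sigma,\beta)=\sum_{a,x,y}\beta_{a,1}^{x,y}\,\mathrm{tr}[E_1(\sigma_{a|x}\otimes\omega_y)],\qquad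 I_{\mathsf{LHS},E_1}(\beta)=\sup_{\tau\in\mathsf{LHS}}I_{E_1}(\tau,\beta).$$ The MDI steering measure is $$\mathcal S^{\mathrm{MDI}}(\sigma)=\max\{\mathcal S_0^{\mathrm{MDI}}(\sigma)-1,0\},\qquad \mathcal S_0^{\mathrm{MDI}}(\sigma)=\sup_{\beta,E_1}\frac{I_{E_1}(\sigma,\beta)}{I_{\mathsf{LHS},E_1}(\beta)},$$ where the supremum is over all effects $E_1$ and all $\beta$ with $F_{a|x}=\sum_y\beta_{a,1}^{x,y}\omega_y^{\mathsf T}\ge 0$ for all $a,x$, such that $I_{\mathsf{LHS},E_1}(\beta)>0$. The steering fraction $S_F$ and the steering robustness $S_R$ are $$S_F(\sigma)+1=\max_{F_{a|x}\ge 0,\ F\ne 0}\frac{\mathrm{tr}\sum_{a,x}F_{a|x}\sigma_{a|x}}{\max_{\tau\in\mathsf{LHS}}\mathrm{tr}\sum_{a,x}F_{a|x}\tau_{a|x}},$$ $$S_R(\sigma)=\min\Big\{t\ge 0:\ \Big\{\tfrac{\sigma_{a|x}+t\,\tau_{a|x}}{1+t}\Big\}\in\mathsf{LHS}\ \text{for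 some assemblage}\ \{\tau_{a|x}\}\Big\}.$$ **Theorem 1.** For every choice of tomographically complete question sets (possibly a different one for each scenario) and every assemblage $\sigma$, the suprema defining $\mathcal S^{\mathrm{MDI}}$ are finite, the maxima and the minimum defining $S_F$ and $S_R$ are attained, and $$\mathcal S^{\mathrm{MDI}}(\sigma)=S_F(\sigma)=S_R(\sigma).$$ Moreover $S_R(\sigma)+1$ equals the maximum of $\mathrm{tr}\sum_{a,x}F_{a|x}\sigma_{a|x}$ over $F_{a|x}\ge 0$ with $\sum_{a,x}D(a|x,\lambda)F_{a|x}\le 1$ for every deterministic strategy $D(a|x,\lambda)=\delta_{a,\lambda(x)}$. Consequently $\mathcal S^{\mathrm{MDI}}$ is a convex steering monotone in the sense of Gallego and Aolita: it is nonnegative; it vanishes on $\mathsf{LHS}$; it is convex, $\mathcal S^{\mathrm{MDI}}(\mu\sigma+(1-\mu)\sigma')\le\mu\,\mathcal S^{\mathrm{MDI}}(\sigma)+(1-\mu)\,\mathcal S^{\mathrm{MDI}}(\sigma')$ for assemblages $\sigma,\sigma'$ of the same scenario and $0\le\mu\le1$; and it does not increase on average under deterministic one-way LOCC, i.e. $$\sum_w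 P(w)\,\mathcal S^{\mathrm{MDI}}\big(M_w(\sigma)/P(w)\big)\le\mathcal S^{\mathrm{MDI}}(\sigma),\qquad P(w)=\mathrm{tr}\sum_{a'}M_w(\sigma)_{a'|x'},$$ (terms with $P(w)=0$ count as $0$; $P(w)$ does not depend on $x'$) for every finite family of maps $$M_w(\sigma)_{a'|x'}=K_w\Big(\sum_{a,x}P(x|x',w)\,P(a'|a,x,w,x')\,\sigma_{a|x}\Big)K_w^\dagger,\qquad \sum_wK_w^\dagger K_w=1,$$ with conditional probability distributions $P(x|x',w)$ and $P(a'|a,x,w,x')$, where the final dimension and the final sets of inputs $x'$ and outputs $a'$ may differ from the initial ones. -/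

import Mathlib

open scoped Matrix Kronecker ComplexOrder

noncomputable section

/-- Families of operators `σ_{a|x}` on Bob's `d`-dimensional space, with outcomes `a` in a set of
`nA` elements and settings `x` in a set of `nX` elements. -/
abbrev OpFamily (nA nX d : ℕ) : Type := Fin nA → Fin nX → Matrix (Fin d) (Fin d) ℂ

/-- Density matrices. -/
def IsDensity {d : ℕ} (ρ : Matrix (Fin d) (Fin d) ℂ) : Prop :=
  ρ.PosSemidef ∧ ρ.trace = 1

/-- Effects of a two-outcome measurement `{E, 1 - E}` on the joint system `B B₀`. -/
def IsEffect {d : ℕ} (E : Matrix (Fin d × Fin d) (Fin d × Fin d) ℂ) : Prop :=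
  E.PosSemidef ∧ (1 - E).PosSemidef

/-- Assemblages: positive semidefinite operators with a common normalised marginal on Bob's side
(no signalling). These are exactly the families `tr_A (ρ_AB (E_{a|x} ⊗ 1))`. -/
def IsAssemblage {nA nX d : ℕ} (σ : OpFamily nA nX d) : Prop :=
  (∀ a x, (σ a x).PosSemidef) ∧
    ∃ ρ : Matrix (Fin d) (Fin d) ℂ, IsDensity ρ ∧ ∀ x, ∑ a, σ a x = ρ

/-- Probability vectors on a finite set. -/
def IsProb {k : ℕ} (p : Fin k → ℝ) : Prop :=
  (∀ i, 0 ≤ p i) ∧ ∑ i, p i = 1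

/-- Unsteerable assemblages, i.e. those with a local-hidden-state model
`τ_{a|x} = ∑_l p(l) p(a|x,l) ρ_l`. -/
def IsUnsteerable {nA nX d : ℕ} (τ : OpFamily nA nX d) : Prop :=
  ∃ (m : ℕ) (p : Fin m → ℝ) (resp : Fin m → Fin nX → Fin nA → ℝ)
    (ρ : Fin m → Matrix (Fin d) (Fin d) ℂ),
    IsProb p ∧ (∀ l x, IsProb (resp l x)) ∧ (∀ l, IsDensity (ρ l)) ∧
      ∀ a x, τ a x = ∑ l, (p l * resp l x a) • ρ l

/-- A finite tomographically complete set of quantum questions `ω_y` on Bob's input system `B₀`,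
which has the same dimension as `B`: density matrices whose real span contains all Hermitian
matrices. -/
structure QuestionSet (d : ℕ) where
  /-- number of questions -/
  card : ℕ
  /-- the states `ω_y` -/
  state : Fin card → Matrix (Fin d) (Fin d) ℂ
  isDensity : ∀ y, IsDensity (state y)
  complete : ∀ H : Matrix (Fin d) (Fin d) ℂ, H.IsHermitian →
    ∃ c : Fin card → ℝ, H = ∑ y, c y • state y

/-! ### The measurement-device-independent steering measure -/

/-- The observed statistics `p(a,1|x,ω_y) = tr (E₁ (σ_{a|x} ⊗ ω_y))`. -/
def stat {nA nX d : ℕ} (ω : QuestionSet d) (E : Matrix (Fin d × Fin d) (Fin d × Fin d) ℂ)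
    (σ : OpFamily nA nX d) : Fin nA → Fin nX → Fin ω.card → ℝ :=
  fun a x y => (E * (σ a x ⊗ₖ ω.state y)).trace.re

/-- The average payoff `I(P, β) = ∑_{a,x,y} β_{a,1}^{x,y} p(a,1|x,ω_y)`. -/
def payoff {nA nX k : ℕ} (P β : Fin nA → Fin nX → Fin k → ℝ) : ℝ :=
  ∑ a, ∑ x, ∑ y, β a x y * P a x y

/-- Admissible games: the operators `F_{a|x} = ∑_y β_{a,1}^{x,y} ω_yᵀ` are positive
semidefinite. -/
def IsGame {nA nX d : ℕ} (ω : QuestionSet d) (β : Fin nA → Fin nX → Fin ω.card → ℝ) : Prop :=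
  ∀ a x, (∑ y, β a x y • (ω.state y)ᵀ).PosSemidef

/-- The payoffs of the game `β` that unsteerable assemblages produce with Bob's effect `E`. -/
def lhsPayoffs {nA nX d : ℕ} (ω : QuestionSet d)
    (E : Matrix (Fin d × Fin d) (Fin d × Fin d) ℂ) (β : Fin nA → Fin nX → Fin ω.card → ℝ) :
    Set ℝ :=
  {r | ∃ τ : OpFamily nA nX d, IsUnsteerable τ ∧ r = payoff (stat ω E τ) β}

/-- The LHS bound `I_LHS(β)`. -/
def lhsPayoff {nA nX d : ℕ} (ω : QuestionSet d)
    (E : Matrix (Fin d × Fin d) (Fin d × Fin d) ℂ) (β : Fin nA → Fin nX → Fin ω.card → ℝ) : ℝ :=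
  sSup (lhsPayoffs ω E β)

/-- The ratios `I(P, β) / I_LHS(β)` over admissible games `β` and effects `E₁` of Bob for which
the LHS bound is positive. -/
def mdiRatios {nA nX d : ℕ} (ω : QuestionSet d) (σ : OpFamily nA nX d) : Set ℝ :=
  {r | ∃ (β : Fin nA → Fin nX → Fin ω.card → ℝ)
      (E : Matrix (Fin d × Fin d) (Fin d × Fin d) ℂ),
      IsGame ω β ∧ IsEffect E ∧ 0 < lhsPayoff ω E β ∧
        r = payoff (stat ω E σ) β / lhsPayoff ω E β}

/-- The MDI steering measure `max {S₀ - 1, 0}`, where `S₀` is the supremum of the ratios. -/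
def mdiMeasure {nA nX d : ℕ} (ω : QuestionSet d) (σ : OpFamily nA nX d) : ℝ :=
  max (sSup (mdiRatios ω σ) - 1) 0

/-! ### Steering fraction and steering robustness -/

/-- The value `tr ∑_{a,x} F_{a|x} σ_{a|x}`. -/
def witnessValue {nA nX d : ℕ} (F σ : OpFamily nA nX d) : ℝ :=
  (∑ a, ∑ x, (F a x * σ a x).trace).re

/-- The values of the witness `F` on unsteerable assemblages. -/
def lhsValues {nA nX d : ℕ} (F : OpFamily nA nX d) : Set ℝ :=
  {r | ∃ τ : OpFamily nA nX d, IsUnsteerable τ ∧ r = witnessValue F τ}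

/-- The local bound of the witness `F`. -/
def lhsBound {nA nX d : ℕ} (F : OpFamily nA nX d) : ℝ :=
  sSup (lhsValues F)

/-- The ratios whose maximum is one plus the steering fraction. -/
def fractionRatios {nA nX d : ℕ} (σ : OpFamily nA nX d) : Set ℝ :=
  {r | ∃ F : OpFamily nA nX d, (∀ a x, (F a x).PosSemidef) ∧ 0 < lhsBound F ∧
      r = witnessValue F σ / lhsBound F}

/-- The steering fraction. -/
def steeringFraction {nA nX d : ℕ} (σ : OpFamily nA nX d) : ℝ :=
  sSup (fractionRatios σ) - 1

/-- The amounts `t` of noise, an arbitrary assemblage `τ`, that make `(σ + t τ) / (1 + t)`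
unsteerable. -/
def robustnessSet {nA nX d : ℕ} (σ : OpFamily nA nX d) : Set ℝ :=
  {t | 0 ≤ t ∧ ∃ τ : OpFamily nA nX d, IsAssemblage τ ∧
      IsUnsteerable (fun a x => (1 + t)⁻¹ • (σ a x + t • τ a x))}

/-- The steering robustness. -/
def steeringRobustness {nA nX d : ℕ} (σ : OpFamily nA nX d) : ℝ :=
  sInf (robustnessSet σ)

/-- The objective values of the dual semidefinite program of the steering robustness. The
deterministic strategies are the maps `s` from settings to outcomes, with
`D(a|x,s) = 1` if `a = s x` and `0` otherwise. -/
def robustnessDualValues {nA nX d : ℕ} (σ : OpFamily nA nX d) : Set ℝ :=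
  {r | ∃ F : OpFamily nA nX d, (∀ a x, (F a x).PosSemidef) ∧
      (∀ s : Fin nX → Fin nA,
        (1 - ∑ a, ∑ x, (if a = s x then (1 : ℂ) else 0) • F a x).PosSemidef) ∧
      r = witnessValue F σ}

/-! ### One-way LOCC and convex steering monotones -/

/-- A deterministic one-way LOCC map (Bob measures with Kraus operators `K_w` and announces `w`;
Alice then classically wires her inputs and outputs), from a scenario with sizes `nA nX d` to one
with sizes `nA' nX' d'`. -/
structure OneWayLOCC (nA nX d nA' nX' d' : ℕ) where
  /-- number of Bob's outcomes -/
  card : ℕ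
  /-- Bob's Kraus operators -/
  kraus : Fin card → Matrix (Fin d') (Fin d) ℂ
  kraus_complete : ∑ w, (kraus w)ᴴ * kraus w = 1
  /-- `inProb w x' x` is the probability `P(x | x', w)` of the initial setting `x` -/
  inProb : Fin card → Fin nX' → Fin nX → ℝ
  inProb_isProb : ∀ w x', IsProb (inProb w x')
  /-- `outProb w x' x a a'` is the probability `P(a' | a, x, w, x')` of the final outcome `a'` -/
  outProb : Fin card → Fin nX' → Fin nX → Fin nA → Fin nA' → ℝ
  outProb_isProb : ∀ w x' x a, IsProb (outProb w x' x a)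

/-- The branch `M_w (σ) = K_w W_w(σ) K_wᴴ`, with the wiring
`W_w(σ)_{a'|x'} = ∑_{a,x} P(x | x', w) P(a' | a, x, w, x') σ_{a|x}`. -/
def OneWayLOCC.branch {nA nX d nA' nX' d' : ℕ} (M : OneWayLOCC nA nX d nA' nX' d')
    (w : Fin M.card) (σ : OpFamily nA nX d) : OpFamily nA' nX' d' :=
  fun a' x' => M.kraus w *
    (∑ a, ∑ x, (M.inProb w x' x * M.outProb w x' x a a') • σ a x) * (M.kraus w)ᴴ

/-- Bob's reduced state `∑_a σ_{a|x}`, which does not depend on `x` for an assemblage. -/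
def reducedState {nA nX d : ℕ} [NeZero nX] (σ : OpFamily nA nX d) : Matrix (Fin d) (Fin d) ℂ :=
  ∑ a, σ a 0

/-- The probability `P(w) = tr (M_w(σ))` of the branch `w`. -/
def OneWayLOCC.prob {nA nX d nA' nX' d' : ℕ} [NeZero nX'] (M : OneWayLOCC nA nX d nA' nX' d')
    (w : Fin M.card) (σ : OpFamily nA nX d) : ℝ :=
  (reducedState (M.branch w σ)).trace.re

/-- Convex steering monotones in the resource theory of steering: nonnegative functions of
assemblages (in all finite scenarios) that vanish on unsteerable assemblages, do not increase on
average under deterministic one-way LOCC, and are convex. A branch of probability `0` contributes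
`0` to the average. -/
structure IsConvexSteeringMonotone (S : ∀ nA nX d : ℕ, OpFamily nA nX d → ℝ) : Prop where
  nonneg : ∀ (nA nX d : ℕ) [NeZero nX] (σ : OpFamily nA nX d), IsAssemblage σ → 0 ≤ S nA nX d σ
  vanish : ∀ (nA nX d : ℕ) [NeZero nX] (σ : OpFamily nA nX d), IsUnsteerable σ →
    S nA nX d σ = 0
  monotone : ∀ (nA nX d nA' nX' d' : ℕ) [NeZero nX] [NeZero nX']
    (M : OneWayLOCC nA nX d nA' nX' d') (σ : OpFamily nA nX d), IsAssemblage σ →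
    ∑ w, M.prob w σ * S nA' nX' d' (fun a x => (M.prob w σ)⁻¹ • M.branch w σ a x) ≤
      S nA nX d σ
  convex : ∀ (nA nX d : ℕ) [NeZero nX] (σ σ' : OpFamily nA nX d), IsAssemblage σ →
    IsAssemblage σ' → ∀ μ : ℝ, 0 ≤ μ → μ ≤ 1 →
    S nA nX d (fun a x => μ • σ a x + (1 - μ) • σ' a x) ≤
      μ * S nA nX d σ + (1 - μ) * S nA nX d σ'

end

/-! ### Positive semidefinite matrices and the trace pairing -/

/-! Everything reduces to one number: the least weight `c` for which `σ` lies below an unnormalised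
local-hidden-state model `∑ₛ D(a|x,s) Hₛ` with `∑ₛ tr Hₛ = c` (`IsDominated`). Stochastic responses
are mixtures of deterministic ones, so such models exhaust LHS when `c = 1`.

The dual program maximises the pairing of `F ≥ 0` with `σ` under `∑ₓ F_{s x|x} ≤ 1` for every
strategy `s` (`IsDualFeasible`). Weak duality is positivity of the trace pairing. For strong
duality, compactness gives a dual optimum of value `v`. If no model of weight `v` dominated `σ`,
Hahn-Banach would separate the compact set of models of weight at most `v` from the closed set of
families above `σ`. The separating functional is a positive witness, and rescaling it gives a dual
point of value above `v` (`exists_isDualFeasible_isDominated`).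

The number `v` is then read in three ways. The normalised excess of a dominating model over `σ` is
the noise in the robustness, so `S_R + 1 = v`. Scaling a witness to local bound `1` makes it dual
feasible, so `S_F + 1 = v`. A game with an effect of Bob induces a positive witness by partial
trace, and the maximally entangled projection realises every witness for which the local bound is
positive, so the MDI ratios and the fraction ratios are the same set
(`mdiRatios_eq_fractionRatios`).

The monotone axioms come from the primal side: domination survives scaling, addition and the
branches of one-way LOCC, and the branch weights add up to the original weight. -/

theorem posSemidef_real_smul {n : Type*} {A : Matrix n n ℂ} (hA : A.PosSemidef) {c : ℝ}
    (hc : 0 ≤ c) : (c • A).PosSemidef := hA.smul hc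

section PosSemidef

variable {n m : Type*} [Fintype n] [Fintype m]

open scoped MatrixOrder in
theorem trace_mul_nonneg_of_posSemidef {A B : Matrix n n ℂ} (hA : A.PosSemidef)
    (hB : B.PosSemidef) : 0 ≤ (A * B).trace := by
  classical
  obtain ⟨X, rfl⟩ := CStarAlgebra.nonneg_iff_eq_star_mul_self.mp hA.nonneg
  rw [Matrix.mul_assoc, Matrix.trace_mul_comm]
  exact (hB.mul_mul_conjTranspose_same X).trace_nonneg

theorem trace_mul_vecMulVec_star (A : Matrix n n ℂ) (u : n → ℂ) :
    (A * Matrix.vecMulVec u (star u)).trace = star u ⬝ᵥ (A *ᵥ u) := by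
  rw [Matrix.mul_vecMulVec, Matrix.trace_vecMulVec, dotProduct_comm]

/-- Self-duality of the positive cone; rank-one `B` already suffice as tests. -/
theorem posSemidef_of_re_trace_mul_nonneg {A : Matrix n n ℂ} (hA : A.IsHermitian)
    (h : ∀ B : Matrix n n ℂ, B.PosSemidef → 0 ≤ (A * B).trace.re) : A.PosSemidef := by
  refine .of_dotProduct_mulVec_nonneg hA fun u => ?_
  have h1 := h _ (Matrix.posSemidef_vecMulVec_self_star u)
  rw [trace_mul_vecMulVec_star] at h1
  exact Complex.le_def.2 ⟨h1, (hA.im_star_dotProduct_mulVec_self u).symm⟩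

/-- The principal 2×2 minor on `i, j` is nonnegative, so `|A i j|²` is at most the product of two
diagonal entries. This is the source of all boundedness below: a trace bound controls every entry.
-/
theorem norm_apply_le_re_trace_of_posSemidef {A : Matrix n n ℂ} (hA : A.PosSemidef) (i j : n) :
    ‖A i j‖ ≤ A.trace.re := by
  have hd : ∀ k, 0 ≤ (A k k).re := fun k => (Complex.le_def.1 hA.diag_nonneg).1
  have him : ∀ k, (A k k).im = 0 := fun k => (Complex.le_def.1 hA.diag_nonneg).2.symm
  have ht : ∀ k, (A k k).re ≤ A.trace.re := fun k => by
    rw [Matrix.trace, Complex.re_sum]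
    exact Finset.single_le_sum (f := fun k => (A k k).re) (fun k _ => hd k) (Finset.mem_univ k)
  have h2 := (hA.submatrix ![i, j]).det_nonneg
  have hs : A j i = star (A i j) := (hA.isHermitian.apply j i).symm
  rw [Matrix.det_fin_two] at h2
  simp only [Matrix.submatrix_apply, Matrix.cons_val_zero, Matrix.cons_val_one, hs] at h2
  have h3 := (Complex.le_def.1 h2).1
  have h4 : ‖A i j‖ ^ 2 ≤ (A i i).re * (A j j).re := by
    rw [Complex.sq_norm, Complex.normSq_apply]
    simp [him] at h3
    linarith
  have h5 : (0:ℝ) ≤ A.trace.re := (hd i).trans (ht i)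
  refine abs_le_of_sq_le_sq' (h4.trans ?_) h5 |>.2
  rw [sq]
  exact mul_le_mul (ht i) (ht j) (hd j) h5

theorem isClosed_setOf_posSemidef : IsClosed {A : Matrix n n ℂ | A.PosSemidef} := by
  simp only [Matrix.posSemidef_iff_dotProduct_mulVec, Set.ofPred_and, Set.ofPred_forall]
  refine IsClosed.inter (isClosed_eq (by fun_prop) continuous_id) (isClosed_iInter fun u => ?_)
  exact isClosed_le continuous_const (by fun_prop)

theorem re_trace_nonneg_of_posSemidef {A : Matrix n n ℂ} (hA : A.PosSemidef) :
    0 ≤ A.trace.re := (Complex.le_def.1 hA.trace_nonneg).1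

theorem ofReal_re_trace_of_posSemidef {A : Matrix n n ℂ} (hA : A.PosSemidef) :
    (A.trace.re : ℂ) = A.trace :=
  Complex.ext rfl (Complex.le_def.1 hA.trace_nonneg).2

/-- The partial trace `tr_B [E (1 ⊗ ω)]`, characterised by
`tr (E (σ ⊗ ω)) = tr (tr_B [E (1 ⊗ ω)] σ)`. -/
def partialTraceMul (E : Matrix (n × m) (n × m) ℂ) (ω : Matrix m m ℂ) : Matrix n n ℂ :=
  Matrix.of fun i j => ∑ k, ∑ l, E (i, k) (j, l) * ω l k

theorem trace_mul_kronecker (E : Matrix (n × m) (n × m) ℂ) (σ : Matrix n n ℂ)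
    (ω : Matrix m m ℂ) :
    (E * (σ ⊗ₖ ω)).trace = (partialTraceMul E ω * σ).trace := by
  simp only [Matrix.trace, Matrix.diag_apply, Matrix.mul_apply, Matrix.kroneckerMap_apply,
    Fintype.sum_prod_type, partialTraceMul, Matrix.of_apply, Finset.sum_mul]
  refine Finset.sum_congr rfl fun i _ => ?_
  rw [Finset.sum_comm]
  refine Finset.sum_congr rfl fun j _ => Finset.sum_congr rfl fun k _ =>
    Finset.sum_congr rfl fun l _ => by ring

omit [Fintype n] in
theorem partialTraceMul_sum_smul {ι : Type*} (s : Finset ι) (E : Matrix (n × m) (n × m) ℂ)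
    (c : ι → ℝ) (ω : ι → Matrix m m ℂ) :
    partialTraceMul E (∑ y ∈ s, c y • ω y) = ∑ y ∈ s, c y • partialTraceMul E (ω y) := by
  ext i j
  simp only [partialTraceMul, Matrix.of_apply, Matrix.sum_apply, Matrix.smul_apply,
    Finset.mul_sum, Finset.smul_sum]
  symm
  rw [Finset.sum_comm]
  refine Finset.sum_congr rfl fun k _ => ?_
  rw [Finset.sum_comm]
  exact Finset.sum_congr rfl fun l _ => Finset.sum_congr rfl fun y _ => (mul_smul_comm _ _ _).symm

/-- By self-duality it is enough to pair with `B ≥ 0`, and that pairing is `tr (E (B ⊗ ω))`, a trace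
of a product of positive matrices. -/
theorem posSemidef_partialTraceMul {E : Matrix (n × m) (n × m) ℂ} {ω : Matrix m m ℂ}
    (hE : E.PosSemidef) (hω : ω.PosSemidef) : (partialTraceMul E ω).PosSemidef := by
  refine posSemidef_of_re_trace_mul_nonneg ?_ fun B hB => ?_
  · ext i j
    simp only [partialTraceMul, Matrix.conjTranspose_apply, Matrix.of_apply, star_sum, star_mul']
    rw [Finset.sum_comm]
    refine Finset.sum_congr rfl fun k _ => Finset.sum_congr rfl fun l _ => ?_
    rw [hE.isHermitian.apply, hω.isHermitian.apply]
  · classical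
    rw [← trace_mul_kronecker]
    exact (Complex.le_def.1 (trace_mul_nonneg_of_posSemidef hE (hB.kronecker hω))).1

end PosSemidef

/-! ### Mixtures of deterministic strategies -/

section DeterministicMixture

variable {nA nX d : ℕ}

/-- The assemblage `∑_s D(a|x,s) H_s` generated by operators `H_s` attached to the deterministic
strategies `s`. -/
def deterministicMix (H : (Fin nX → Fin nA) → Matrix (Fin d) (Fin d) ℂ) : OpFamily nA nX d :=
  fun a x => ∑ s, if s x = a then H s else 0

/-- The operator `∑_{a,x} D(a|x,s) F_{a|x}`. -/
def strategySum (F : OpFamily nA nX d) (s : Fin nX → Fin nA) : Matrix (Fin d) (Fin d) ℂ :=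
  ∑ x, F (s x) x

theorem strategySum_eq_sum_ite (F : OpFamily nA nX d) (s : Fin nX → Fin nA) :
    ∑ a, ∑ x, (if a = s x then (1 : ℂ) else 0) • F a x = strategySum F s := by
  rw [Finset.sum_comm]
  simp [strategySum]

theorem posSemidef_strategySum {F : OpFamily nA nX d} (hF : ∀ a x, (F a x).PosSemidef)
    (s : Fin nX → Fin nA) : (strategySum F s).PosSemidef :=
  Matrix.posSemidef_sum _ fun x _ => hF (s x) x

theorem posSemidef_deterministicMix {H : (Fin nX → Fin nA) → Matrix (Fin d) (Fin d) ℂ}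
    (hH : ∀ s, (H s).PosSemidef) (a : Fin nA) (x : Fin nX) :
    (deterministicMix H a x).PosSemidef :=
  Matrix.posSemidef_sum _ fun s _ => by split_ifs; exacts [hH s, .zero]

theorem sum_deterministicMix (H : (Fin nX → Fin nA) → Matrix (Fin d) (Fin d) ℂ) (x : Fin nX) :
    ∑ a, deterministicMix H a x = ∑ s, H s := by
  simp only [deterministicMix]
  rw [Finset.sum_comm]
  simp

theorem deterministicMix_smul (c : ℝ) (H : (Fin nX → Fin nA) → Matrix (Fin d) (Fin d) ℂ)
    (a : Fin nA) (x : Fin nX) :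
    deterministicMix (fun s => c • H s) a x = c • deterministicMix H a x := by
  simp only [deterministicMix, Finset.smul_sum, smul_ite, smul_zero]

theorem witnessValue_deterministicMix (F : OpFamily nA nX d)
    (H : (Fin nX → Fin nA) → Matrix (Fin d) (Fin d) ℂ) :
    witnessValue F (deterministicMix H) = ∑ s, (strategySum F s * H s).trace.re := by
  rw [witnessValue, ← Complex.re_sum]
  congr 1
  simp only [deterministicMix, strategySum, Finset.mul_sum, Finset.sum_mul, Matrix.trace_sum]
  rw [Finset.sum_comm]
  symm
  rw [Finset.sum_comm]
  refine Finset.sum_congr rfl fun x _ => ?_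
  symm
  rw [Finset.sum_comm]
  refine Finset.sum_congr rfl fun s _ => ?_
  simp [mul_ite, apply_ite Matrix.trace]

theorem prob_prod_marginal (r : Fin nX → Fin nA → ℝ) (hr : ∀ x, IsProb (r x)) (a : Fin nA)
    (x : Fin nX) : (∑ s : Fin nX → Fin nA, if s x = a then ∏ x', r x' (s x') else 0) = r x a := by
  -- The indicator of `s x = a` is absorbed as a factor at the setting `x`, so that the sum over
  -- strategies of a product becomes a product over settings of sums.
  have h : ∀ s : Fin nX → Fin nA, (if s x = a then ∏ x', r x' (s x') else 0)
      = ∏ x', r x' (s x') * (if x' = x then if s x' = a then 1 else 0 else 1) := fun s => by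
    rw [Finset.prod_mul_distrib, Finset.prod_ite_eq']
    simp
  simp only [h]
  rw [← Fintype.piFinset_univ, ← Finset.prod_univ_sum (fun _ => Finset.univ)
    (fun x' a' => r x' a' * (if x' = x then if a' = a then 1 else 0 else 1)),
    Finset.prod_eq_single x]
  · simp
  · intro x' _ hx'
    simp [hx', (hr x').2]
  · simp

theorem prob_prod_sum (r : Fin nX → Fin nA → ℝ) (hr : ∀ x, IsProb (r x)) :
    ∑ s : Fin nX → Fin nA, ∏ x, r x (s x) = 1 := by
  rw [← Fintype.piFinset_univ, ← Finset.prod_univ_sum]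
  exact Finset.prod_eq_one fun x _ => (hr x).2

/-- Stochastic responses can be replaced by mixtures of deterministic ones. -/
theorem exists_deterministicMix_eq {ι : Type*} [Fintype ι] (r : ι → Fin nX → Fin nA → ℝ)
    (hr : ∀ l x, IsProb (r l x)) (R : ι → Matrix (Fin d) (Fin d) ℂ)
    (hR : ∀ l, (R l).PosSemidef) :
    ∃ H : (Fin nX → Fin nA) → Matrix (Fin d) (Fin d) ℂ, (∀ s, (H s).PosSemidef) ∧
      ∑ s, H s = ∑ l, R l ∧ ∀ a x, ∑ l, r l x a • R l = deterministicMix H a x := by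
  -- Given `l`, the answers to the different settings are drawn independently; the product is the
  -- probability of the strategy `s`.
  refine ⟨fun s => ∑ l, (∏ x, r l x (s x)) • R l, fun s => Matrix.posSemidef_sum _ fun l _ =>
    posSemidef_real_smul (hR l) (Finset.prod_nonneg fun x _ => (hr l x).1 _), ?_, fun a x => ?_⟩
  · rw [Finset.sum_comm]
    refine Finset.sum_congr rfl fun l _ => ?_
    rw [← Finset.sum_smul, prob_prod_sum _ (hr l), one_smul]
  · simp only [deterministicMix]
    have h : ∀ s : Fin nX → Fin nA, (if s x = a then ∑ l, (∏ x, r l x (s x)) • R l else 0)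
        = ∑ l, (if s x = a then ∏ x, r l x (s x) else 0) • R l := fun s => by
      split_ifs <;> simp
    simp only [h]
    rw [Finset.sum_comm]
    refine Finset.sum_congr rfl fun l _ => ?_
    rw [← Finset.sum_smul, prob_prod_marginal (r l) (hr l) a x]

/-- The strategy itself is the hidden variable, drawn with probability `tr Hₛ`. -/
theorem isUnsteerable_deterministicMix {H : (Fin nX → Fin nA) → Matrix (Fin d) (Fin d) ℂ}
    (hH : ∀ s, (H s).PosSemidef) (hH1 : (∑ s, H s).trace.re = 1) :
    IsUnsteerable (deterministicMix H) := by
  classical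
  have hsum : (∑ s, H s).PosSemidef := Matrix.posSemidef_sum _ fun s _ => hH s
  let e := Fintype.equivFin (Fin nX → Fin nA)
  let ρ : (Fin nX → Fin nA) → Matrix (Fin d) (Fin d) ℂ := fun s =>
    if (H s).trace = 0 then ∑ s, H s else ((H s).trace.re)⁻¹ • H s
  have hre : ∀ s, (H s).trace ≠ 0 → (H s).trace.re ≠ 0 := fun s h h0 => h <| by
    rw [← ofReal_re_trace_of_posSemidef (hH s), h0, Complex.ofReal_zero]
  have hρ : ∀ s, (H s).trace.re • ρ s = H s := fun s => by
    by_cases h : (H s).trace = 0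
    · simp [ρ, (hH s).trace_eq_zero_iff.1 h]
    · simp only [ρ, if_neg h, smul_smul, mul_inv_cancel₀ (hre s h), one_smul]
  have hρd : ∀ s, IsDensity (ρ s) := fun s => by
    by_cases h : (H s).trace = 0
    · simp only [ρ, if_pos h]
      refine ⟨hsum, ?_⟩
      rw [← ofReal_re_trace_of_posSemidef hsum, hH1, Complex.ofReal_one]
    · simp only [ρ, if_neg h]
      refine ⟨posSemidef_real_smul (hH s) (inv_nonneg.2 (re_trace_nonneg_of_posSemidef (hH s))), ?_⟩
      rw [Matrix.trace_smul, ← ofReal_re_trace_of_posSemidef (hH s), Complex.real_smul,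
        ← Complex.ofReal_mul, Complex.ofReal_re, inv_mul_cancel₀ (hre s h), Complex.ofReal_one]
  refine ⟨_, fun l => (H (e.symm l)).trace.re, fun l x a => if e.symm l x = a then 1 else 0,
    fun l => ρ (e.symm l), ⟨fun l => re_trace_nonneg_of_posSemidef (hH _), ?_⟩,
    fun l x => ⟨fun a => by dsimp only; split_ifs <;> simp, by simp⟩, fun l => hρd _, fun a x => ?_⟩
  · rw [e.symm.sum_comp (fun s => (H s).trace.re), ← Complex.re_sum, ← Matrix.trace_sum, hH1]
  · rw [e.symm.sum_comp (fun s => ((H s).trace.re * if s x = a then 1 else 0) • ρ s)]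
    refine Finset.sum_congr rfl fun s _ => ?_
    split_ifs
    · rw [mul_one, hρ]
    · rw [mul_zero, zero_smul]

theorem IsUnsteerable.exists_eq_deterministicMix {τ : OpFamily nA nX d} (hτ : IsUnsteerable τ) :
    ∃ H : (Fin nX → Fin nA) → Matrix (Fin d) (Fin d) ℂ,
      (∀ s, (H s).PosSemidef) ∧ (∑ s, H s).trace.re = 1 ∧ τ = deterministicMix H := by
  obtain ⟨m, p, r, ρ, hp, hr, hρ, h⟩ := hτ
  obtain ⟨H, hH, hsum, hmix⟩ := exists_deterministicMix_eq r hr (fun l => p l • ρ l)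
    fun l => posSemidef_real_smul (hρ l).1 (hp.1 l)
  refine ⟨H, hH, ?_, ?_⟩
  · rw [hsum, Matrix.trace_sum, Complex.re_sum, ← hp.2]
    exact Finset.sum_congr rfl fun l _ => by simp [(hρ l).2]
  · funext a x
    rw [h, ← hmix]
    exact Finset.sum_congr rfl fun l _ => by rw [smul_smul, mul_comm]

theorem IsUnsteerable.isAssemblage {τ : OpFamily nA nX d} (hτ : IsUnsteerable τ) :
    IsAssemblage τ := by
  obtain ⟨H, hH, hH1, rfl⟩ := hτ.exists_eq_deterministicMix
  have hsum : (∑ s, H s).PosSemidef := Matrix.posSemidef_sum _ fun s _ => hH s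
  refine ⟨posSemidef_deterministicMix hH, ∑ s, H s, ⟨hsum, ?_⟩, sum_deterministicMix H⟩
  rw [← ofReal_re_trace_of_posSemidef hsum, hH1, Complex.ofReal_one]

end DeterministicMixture

/-! ### Linearity and monotonicity of the witness value -/

section WitnessValue

variable {nA nX d : ℕ}

theorem witnessValue_eq_sum (F σ : OpFamily nA nX d) :
    witnessValue F σ = ∑ a, ∑ x, (F a x * σ a x).trace.re := by
  simp only [witnessValue, Complex.re_sum]

theorem witnessValue_add (F σ τ : OpFamily nA nX d) :
    witnessValue F (σ + τ) = witnessValue F σ + witnessValue F τ := by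
  simp [witnessValue_eq_sum, mul_add, Finset.sum_add_distrib]

theorem witnessValue_smul (F σ : OpFamily nA nX d) (c : ℝ) :
    witnessValue F (c • σ) = c * witnessValue F σ := by
  simp [witnessValue_eq_sum, Finset.mul_sum]

theorem smul_witnessValue (F σ : OpFamily nA nX d) (c : ℝ) :
    witnessValue (c • F) σ = c * witnessValue F σ := by
  simp [witnessValue_eq_sum, Finset.mul_sum]

theorem witnessValue_single (F : OpFamily nA nX d) (a : Fin nA) (x : Fin nX)
    (B : Matrix (Fin d) (Fin d) ℂ) :
    witnessValue F (Pi.single a (Pi.single x B)) = (F a x * B).trace.re := by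
  rw [witnessValue_eq_sum, Finset.sum_eq_single a, Finset.sum_eq_single x]
  · simp
  · intro x' _ h
    simp [h]
  · simp
  · intro a' _ h
    simp [h]
  · simp

theorem witnessValue_nonneg {F σ : OpFamily nA nX d} (hF : ∀ a x, (F a x).PosSemidef)
    (hσ : ∀ a x, (σ a x).PosSemidef) : 0 ≤ witnessValue F σ := by
  rw [witnessValue_eq_sum]
  exact Finset.sum_nonneg fun a _ => Finset.sum_nonneg fun x _ =>
    (Complex.le_def.1 (trace_mul_nonneg_of_posSemidef (hF a x) (hσ a x))).1

theorem witnessValue_le_of_posSemidef_sub {F σ τ : OpFamily nA nX d}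
    (hF : ∀ a x, (F a x).PosSemidef) (h : ∀ a x, (τ a x - σ a x).PosSemidef) :
    witnessValue F σ ≤ witnessValue F τ := by
  have h1 := witnessValue_add F σ (τ - σ)
  rw [add_sub_cancel] at h1
  have h2 : 0 ≤ witnessValue F (τ - σ) := witnessValue_nonneg hF h
  linarith

theorem continuous_witnessValue_left (σ : OpFamily nA nX d) :
    Continuous fun F : OpFamily nA nX d => witnessValue F σ := by
  unfold witnessValue
  fun_prop

theorem continuous_strategySum (s : Fin nX → Fin nA) :
    Continuous fun F : OpFamily nA nX d => strategySum F s := by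
  unfold strategySum
  fun_prop

/-- Evaluation of a witness on a single deterministic strategy. -/
theorem witnessValue_deterministicMix_single (F : OpFamily nA nX d) (s : Fin nX → Fin nA)
    (B : Matrix (Fin d) (Fin d) ℂ) :
    witnessValue F (deterministicMix (Pi.single s B)) = (strategySum F s * B).trace.re := by
  rw [witnessValue_deterministicMix, Finset.sum_eq_single s]
  · simp
  · intro s' _ h
    simp [h]
  · simp

theorem posSemidef_piSingle {ι : Type*} [DecidableEq ι] {B : Matrix (Fin d) (Fin d) ℂ}
    (hB : B.PosSemidef) (i j : ι) :
    ((Pi.single i B : ι → Matrix (Fin d) (Fin d) ℂ) j).PosSemidef := by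
  by_cases h : j = i
  · subst h; simpa using hB
  · simpa [h] using Matrix.PosSemidef.zero

/-- Real linear functionals on Hermitian matrices are trace pairings with Hermitian matrices. -/
theorem exists_isHermitian_trace_repr (g : Matrix (Fin d) (Fin d) ℂ →ₗ[ℝ] ℝ) :
    ∃ A : Matrix (Fin d) (Fin d) ℂ, A.IsHermitian ∧
      ∀ X : Matrix (Fin d) (Fin d) ℂ, X.IsHermitian → g X = (A * X).trace.re := by
  -- The real and imaginary parts of the entries are read off from `g` on the matrix units and on
  -- `I` times them.
  let B : Matrix (Fin d) (Fin d) ℂ := Matrix.of fun j i =>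
    ⟨g (Matrix.single i j 1), -g (Matrix.single i j Complex.I)⟩
  have hB : ∀ X, g X = (B * X).trace.re := fun X => by
    have hX : X = ∑ i, ∑ j, ((X i j).re • Matrix.single i j (1 : ℂ)
        + (X i j).im • Matrix.single i j Complex.I) := by
      conv_lhs => rw [Matrix.matrix_eq_sum_single X]
      refine Finset.sum_congr rfl fun i _ => Finset.sum_congr rfl fun j _ => ?_
      rw [Matrix.smul_single, Matrix.smul_single, ← Matrix.single_add]
      congr 1
      simp
    conv_lhs => rw [hX]
    simp only [map_sum, map_add, map_smul, Matrix.trace, Matrix.diag_apply, Matrix.mul_apply,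
      Complex.re_sum]
    rw [Finset.sum_comm]
    refine Finset.sum_congr rfl fun j _ => Finset.sum_congr rfl fun i _ => ?_
    simp [B, Complex.mul_re]
    ring
  -- Against Hermitian `X`, `B` and `Bᴴ` have the same real pairing, so `B` may be replaced by its
  -- Hermitian part.
  refine ⟨(2⁻¹ : ℝ) • (B + Bᴴ), ?_, fun X hX => ?_⟩
  · rw [Matrix.IsHermitian, Matrix.conjTranspose_smul, Matrix.conjTranspose_add,
      Matrix.conjTranspose_conjTranspose, add_comm]
    simp
  · have h : (Bᴴ * X).trace.re = (B * X).trace.re := by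
      rw [← hX.eq, ← Matrix.conjTranspose_mul, Matrix.trace_conjTranspose, hX.eq,
        Matrix.trace_mul_comm]
      simp
    rw [hB, Matrix.smul_mul, Matrix.trace_smul, Matrix.add_mul, Matrix.trace_add, Complex.smul_re,
      Complex.add_re, h, smul_eq_mul]
    ring

/-- Families of Hermitian witnesses represent all real linear functionals on families of Hermitian
operators. -/
theorem exists_isHermitian_witnessValue_repr (f : OpFamily nA nX d →ₗ[ℝ] ℝ) :
    ∃ F : OpFamily nA nX d, (∀ a x, (F a x).IsHermitian) ∧
      ∀ X : OpFamily nA nX d, (∀ a x, (X a x).IsHermitian) → f X = witnessValue F X := by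
  choose F hF hFX using fun (a : Fin nA) (x : Fin nX) => exists_isHermitian_trace_repr
    (f ∘ₗ LinearMap.single ℝ (fun _ => Fin nX → Matrix (Fin d) (Fin d) ℂ) a ∘ₗ
      LinearMap.single ℝ (fun _ => Matrix (Fin d) (Fin d) ℂ) x)
  refine ⟨F, hF, fun X hX => ?_⟩
  rw [witnessValue_eq_sum]
  have h : X = ∑ a, ∑ x, Pi.single a (Pi.single x (X a x)) := by
    refine (Finset.univ_sum_single X).symm.trans (Finset.sum_congr rfl fun a _ => ?_)
    exact (congrArg (Pi.single a) (Finset.univ_sum_single (X a)).symm).trans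
      (map_sum (AddMonoidHom.single (fun _ => Fin nX → Matrix (Fin d) (Fin d) ℂ) a) _ _)
  conv_lhs => rw [h]
  simp only [map_sum]
  exact Finset.sum_congr rfl fun a _ => Finset.sum_congr rfl fun x _ => hFX a x _ (hX a x)

end WitnessValue

/-! ### Compactness -/

section Compactness

variable {nA nX d : ℕ}

open scoped Matrix.Norms.Elementwise in
theorem isCompact_of_forall_posSemidef {ι : Type*} [Fintype ι]
    {K : Set (ι → Matrix (Fin d) (Fin d) ℂ)} (hK : IsClosed K)
    (hpos : ∀ H ∈ K, ∀ i, (H i).PosSemidef) (c : ℝ)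
    (hc : ∀ H ∈ K, (∑ i, H i).trace.re ≤ c) : IsCompact K := by
  have : ProperSpace (ι → Matrix (Fin d) (Fin d) ℂ) := FiniteDimensional.proper ℝ _
  refine Metric.isCompact_of_isClosed_isBounded hK
    ((Metric.isBounded_closedBall (x := 0) (r := |c|)).subset fun H hH => ?_)
  rw [mem_closedBall_zero_iff, pi_norm_le_iff_of_nonneg (abs_nonneg c)]
  intro i
  rw [Matrix.norm_le_iff (abs_nonneg c)]
  intro j k
  refine (norm_apply_le_re_trace_of_posSemidef (hpos H hH i) j k).trans
    (le_trans ?_ ((hc H hH).trans (le_abs_self c)))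
  rw [Matrix.trace_sum, Complex.re_sum]
  exact Finset.single_le_sum (f := fun i => (H i).trace.re)
    (fun i _ => re_trace_nonneg_of_posSemidef (hpos H hH i)) (Finset.mem_univ i)

theorem isCompact_posSemidef_trace_mem_Icc {ι : Type*} [Fintype ι] (b c : ℝ) :
    IsCompact {H : ι → Matrix (Fin d) (Fin d) ℂ |
      (∀ i, (H i).PosSemidef) ∧ (∑ i, H i).trace.re ∈ Set.Icc b c} := by
  refine isCompact_of_forall_posSemidef ?_ (fun H hH => hH.1) c fun H hH => hH.2.2
  rw [Set.ofPred_and, Set.ofPred_forall]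
  have h : Continuous fun H : ι → Matrix (Fin d) (Fin d) ℂ => (∑ i, H i).trace.re := by fun_prop
  exact (isClosed_iInter fun i =>
    isClosed_setOf_posSemidef.preimage (continuous_apply i)).inter (isClosed_Icc.preimage h)

end Compactness

/-! ### Duality for the steering robustness -/

section Duality

variable {nA nX d : ℕ}

/-- `σ` is dominated by an assemblage with a local-hidden-state model of total weight `c`. -/
def IsDominated (σ : OpFamily nA nX d) (c : ℝ) : Prop :=
  ∃ H : (Fin nX → Fin nA) → Matrix (Fin d) (Fin d) ℂ, (∀ s, (H s).PosSemidef) ∧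
    (∀ a x, (deterministicMix H a x - σ a x).PosSemidef) ∧ (∑ s, H s).trace.re = c

/-- Feasible points of the dual semidefinite program of the steering robustness. -/
def IsDualFeasible (F : OpFamily nA nX d) : Prop :=
  (∀ a x, (F a x).PosSemidef) ∧ ∀ s, (1 - strategySum F s).PosSemidef

theorem mem_robustnessDualValues_iff {σ : OpFamily nA nX d} {r : ℝ} :
    r ∈ robustnessDualValues σ ↔ ∃ F, IsDualFeasible F ∧ r = witnessValue F σ := by
  simp only [robustnessDualValues, Set.mem_ofPred_eq, IsDualFeasible, strategySum_eq_sum_ite,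
    and_assoc]

theorem IsDualFeasible.witnessValue_deterministicMix_le {F : OpFamily nA nX d}
    (hF : IsDualFeasible F) {H : (Fin nX → Fin nA) → Matrix (Fin d) (Fin d) ℂ}
    (hH : ∀ s, (H s).PosSemidef) :
    witnessValue F (deterministicMix H) ≤ (∑ s, H s).trace.re := by
  rw [witnessValue_deterministicMix, Matrix.trace_sum, Complex.re_sum]
  refine Finset.sum_le_sum fun s _ => ?_
  have h := (Complex.le_def.1 (trace_mul_nonneg_of_posSemidef (hF.2 s) (hH s))).1
  rw [Matrix.sub_mul, Matrix.one_mul, Matrix.trace_sub, Complex.sub_re, Complex.zero_re] at h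
  linarith

/-- Weak duality. -/
theorem IsDualFeasible.witnessValue_le {F σ : OpFamily nA nX d} (hF : IsDualFeasible F) {c : ℝ}
    (hσ : IsDominated σ c) : witnessValue F σ ≤ c := by
  obtain ⟨H, hH, hσH, rfl⟩ := hσ
  exact (witnessValue_le_of_posSemidef_sub hF.1 hσH).trans (hF.witnessValue_deterministicMix_le hH)

/-- Pairing `1 - ∑ₓ F_{s x|x}` with a state `B` compares `1` with the value of `F` on the model that
always plays `s` and sends `B`. Homogeneity extends this to all positive `B`. -/
theorem isDualFeasible_of_forall_le {F : OpFamily nA nX d} (hF : ∀ a x, (F a x).PosSemidef)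
    (h : ∀ (s : Fin nX → Fin nA) (B : Matrix (Fin d) (Fin d) ℂ), B.PosSemidef →
      B.trace.re = 1 → witnessValue F (deterministicMix (Pi.single s B)) ≤ 1) :
    IsDualFeasible F := by
  refine ⟨hF, fun s => posSemidef_of_re_trace_mul_nonneg
    (Matrix.isHermitian_one.sub (posSemidef_strategySum hF s).isHermitian) fun B hB => ?_⟩
  rw [Matrix.sub_mul, Matrix.one_mul, Matrix.trace_sub, Complex.sub_re, sub_nonneg]
  rcases (re_trace_nonneg_of_posSemidef hB).eq_or_lt with h0 | h0
  · have hB0 : B = 0 := by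
      rw [← hB.trace_eq_zero_iff, ← ofReal_re_trace_of_posSemidef hB, ← h0, Complex.ofReal_zero]
    simp [hB0]
  · have h1 := h s ((B.trace.re)⁻¹ • B) (posSemidef_real_smul hB (inv_nonneg.2 h0.le))
      (by rw [Matrix.trace_smul, Complex.smul_re, smul_eq_mul, inv_mul_cancel₀ h0.ne'])
    rw [witnessValue_deterministicMix_single, Matrix.mul_smul, Matrix.trace_smul, Complex.smul_re,
      smul_eq_mul, inv_mul_le_iff₀ h0, mul_one] at h1
    exact h1

theorem isCompact_setOf_isDualFeasible :
    IsCompact {F : OpFamily nA nX d | IsDualFeasible F} := by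
  have hcurry : Continuous fun (G : Fin nA × Fin nX → Matrix (Fin d) (Fin d) ℂ) (a : Fin nA)
      (x : Fin nX) => G (a, x) := by fun_prop
  have hclosed : IsClosed {F : OpFamily nA nX d | IsDualFeasible F} := by
    simp only [IsDualFeasible, Set.ofPred_and, Set.ofPred_forall]
    refine IsClosed.inter (isClosed_iInter fun a => isClosed_iInter fun x => ?_)
      (isClosed_iInter fun s => ?_)
    · have h : Continuous fun F : OpFamily nA nX d => F a x := by fun_prop
      exact isClosed_setOf_posSemidef.preimage h
    · exact isClosed_setOf_posSemidef.preimage (continuous_const.sub (continuous_strategySum s))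
  have hcpt : IsCompact {G : Fin nA × Fin nX → Matrix (Fin d) (Fin d) ℂ |
      IsDualFeasible fun a x => G (a, x)} := by
    refine isCompact_of_forall_posSemidef (hclosed.preimage hcurry) (fun G hG i => hG.1 i.1 i.2)
      (∑ _a : Fin nA, (1 : Matrix (Fin d) (Fin d) ℂ).trace.re) fun G hG => ?_
    -- The constant strategies together use each pair `(a, x)` exactly once, so their constraints
    -- alone bound the total trace.
    have h : ∑ i, G i = ∑ a, strategySum (fun a x => G (a, x)) fun _ => a := by
      simp only [strategySum, Fintype.sum_prod_type]
    rw [h, Matrix.trace_sum, Complex.re_sum]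
    refine Finset.sum_le_sum fun a _ => ?_
    have h1 := re_trace_nonneg_of_posSemidef (hG.2 fun _ => a)
    rwa [Matrix.trace_sub, Complex.sub_re, sub_nonneg] at h1
  refine (hcpt.image hcurry).of_isClosed_subset hclosed fun F hF => ?_
  exact ⟨fun i => F i.1 i.2, hF, rfl⟩

/-- The dual point that ignores all settings but one. -/
theorem exists_isDualFeasible_witnessValue_eq_one [NeZero nX] {σ : OpFamily nA nX d}
    (hσ : IsAssemblage σ) : ∃ F, IsDualFeasible F ∧ witnessValue F σ = 1 := by
  obtain ⟨hpos, ρ, hρ, hsum⟩ := hσ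
  refine ⟨fun a x => if x = 0 then 1 else 0, ⟨fun a x => ?_, fun s => ?_⟩, ?_⟩
  · dsimp only
    split_ifs
    exacts [.one, .zero]
  · simpa [strategySum] using Matrix.PosSemidef.zero
  · have h : ∀ a, ∑ x, ((if x = 0 then 1 else 0) * σ a x).trace = (σ a 0).trace := fun a => by
      simp [ite_mul, apply_ite Matrix.trace]
    simp only [witnessValue, h]
    rw [← Matrix.trace_sum, hsum, hρ.2, Complex.one_re]

theorem exists_isMaxOn_isDualFeasible (σ : OpFamily nA nX d) :
    ∃ F, IsDualFeasible F ∧ ∀ F', IsDualFeasible F' → witnessValue F' σ ≤ witnessValue F σ := by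
  obtain ⟨F, hF, hmax⟩ := isCompact_setOf_isDualFeasible.exists_isMaxOn
    ⟨(0 : OpFamily nA nX d), ⟨fun _ _ => .zero, fun s => by simpa [strategySum] using .one⟩⟩
    (continuous_witnessValue_left σ).continuousOn
  exact ⟨F, hF, fun F' hF' => hmax hF'⟩

/-- If `σ` is not dominated with weight at most `v`, then some witness separates it from all
local-hidden-state models of weight at most `v`. -/
theorem exists_separating_witness (σ : OpFamily nA nX d) (hσ : ∀ a x, (σ a x).PosSemidef)
    {v : ℝ} (hv : 0 ≤ v)
    (hno : ∀ c ≤ v, ¬ IsDominated σ c) :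
    ∃ (F : OpFamily nA nX d) (u : ℝ), (∀ a x, (F a x).PosSemidef) ∧ 0 < u ∧
      u < witnessValue F σ ∧ ∀ H : (Fin nX → Fin nA) → Matrix (Fin d) (Fin d) ℂ,
        (∀ s, (H s).PosSemidef) → (∑ s, H s).trace.re ≤ v →
          witnessValue F (deterministicMix H) < u := by
  let D := {H : (Fin nX → Fin nA) → Matrix (Fin d) (Fin d) ℂ |
      (∀ s, (H s).PosSemidef) ∧ (∑ s, H s).trace.re ∈ Set.Icc 0 v}
  have hD : ∀ H : (Fin nX → Fin nA) → Matrix (Fin d) (Fin d) ℂ,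
      (∀ s, (H s).PosSemidef) → (∑ s, H s).trace.re ≤ v → H ∈ D := fun H hH hc =>
    ⟨hH, re_trace_nonneg_of_posSemidef (Matrix.posSemidef_sum _ fun s _ => hH s), hc⟩
  let L : ((Fin nX → Fin nA) → Matrix (Fin d) (Fin d) ℂ) →ₗ[ℝ] OpFamily nA nX d :=
    { toFun := deterministicMix
      map_add' := fun H H' => by
        funext a x
        simp only [deterministicMix, Pi.add_apply, ← Finset.sum_add_distrib]
        exact Finset.sum_congr rfl fun s _ => by split_ifs <;> simp
      map_smul' := fun c H => by
        funext a x
        exact deterministicMix_smul c H a x }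
  have hDconv : Convex ℝ D := by
    intro H hH H' hH' p q hp hq hpq
    refine hD _ (fun s => (posSemidef_real_smul (hH.1 s) hp).add
      (posSemidef_real_smul (hH'.1 s) hq)) ?_
    simp only [Pi.add_apply, Pi.smul_apply, Finset.sum_add_distrib, ← Finset.smul_sum,
      Matrix.trace_add, Matrix.trace_smul, Complex.add_re, Complex.smul_re, smul_eq_mul]
    calc _ ≤ p * v + q * v := by gcongr; exacts [hH.2.2, hH'.2.2]
      _ = v := by rw [← add_mul, hpq, one_mul]
  have hTconv : Convex ℝ {X : OpFamily nA nX d | ∀ a x, (X a x - σ a x).PosSemidef} := by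
    intro X hX Y hY p q hp hq hpq a x
    have h := (posSemidef_real_smul (hX a x) hp).add (posSemidef_real_smul (hY a x) hq)
    convert h using 1
    rw [smul_sub, smul_sub, sub_add_sub_comm, ← add_smul, hpq, one_smul]
    rfl
  have hTclosed : IsClosed {X : OpFamily nA nX d | ∀ a x, (X a x - σ a x).PosSemidef} := by
    simp only [Set.ofPred_forall]
    refine isClosed_iInter fun a => isClosed_iInter fun x => ?_
    have h : Continuous fun X : OpFamily nA nX d => X a x - σ a x := by fun_prop
    exact isClosed_setOf_posSemidef.preimage h
  have : LocallyConvexSpace ℝ (OpFamily nA nX d) :=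
    inferInstanceAs (LocallyConvexSpace ℝ (Fin nA → Fin nX → Fin d → Fin d → ℂ))
  -- The models of weight at most `v` form a compact convex set, the families above `σ` a closed
  -- convex one; a common point would be a domination of weight at most `v`.
  obtain ⟨f, u, w, hfu, huw, hfw⟩ := geometric_hahn_banach_compact_closed
    (hDconv.linear_image L)
    ((isCompact_posSemidef_trace_mem_Icc 0 v).image (LinearMap.continuous_of_finiteDimensional L))
    hTconv hTclosed (by
      rw [Set.disjoint_left]
      rintro _ ⟨H, hH, rfl⟩ hX
      exact hno _ hH.2.2 ⟨H, hH.1, hX, rfl⟩)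
  obtain ⟨F, hFh, hF⟩ := exists_isHermitian_witnessValue_repr (f : OpFamily nA nX d →ₗ[ℝ] ℝ)
  have hσw : w < witnessValue F σ := by
    rw [← hF σ fun a x => (hσ a x).isHermitian]
    exact hfw σ fun a x => by simpa using Matrix.PosSemidef.zero
  have hmix : ∀ H : (Fin nX → Fin nA) → Matrix (Fin d) (Fin d) ℂ,
        (∀ s, (H s).PosSemidef) → (∑ s, H s).trace.re ≤ v →
          witnessValue F (deterministicMix H) < u := fun H hH hHv => by
    rw [← hF _ fun a x => (posSemidef_deterministicMix hH a x).isHermitian]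
    exact hfu _ ⟨H, hD H hH hHv, rfl⟩
  refine ⟨F, u, fun a x => posSemidef_of_re_trace_mul_nonneg (hFh a x) fun B hB => ?_, ?_,
    huw.trans hσw, hmix⟩
  -- The families above `σ` are stable under adding positive operators. If `F a x` paired negatively
  -- with `B`, adding a suitable multiple of `B` at `(a, x)` would bring the value down to exactly
  -- `w`.
  · by_contra! hneg
    have hle : ∀ c : ℝ, 0 ≤ c → w < witnessValue F σ + c * (F a x * B).trace.re := fun c hc => by
      rw [← witnessValue_single, ← witnessValue_smul, ← witnessValue_add]
      have hB' : ∀ a' x', ((c • Pi.single a (Pi.single x B) : OpFamily nA nX d) a' x').PosSemidef := by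
        intro a' x'
        refine posSemidef_real_smul ?_ hc
        by_cases h : a' = a
        · subst h
          simpa using posSemidef_piSingle hB x x'
        · simpa [h] using Matrix.PosSemidef.zero
      refine (hfw _ fun a' x' => ?_).trans_eq
        (hF _ fun a' x' => ((hσ a' x').add (hB' a' x')).isHermitian)
      rw [Pi.add_apply, Pi.add_apply, add_sub_cancel_left]
      exact hB' a' x'
    have h1 := hle ((w - witnessValue F σ) / (F a x * B).trace.re)
      (div_nonneg_of_nonpos (by linarith) hneg.le)
    rw [div_mul_cancel₀ _ hneg.ne] at h1
    linarith
  -- The zero model has value `0`, which lies below the threshold.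
  · have h := hmix 0 (fun _ => .zero) (by simpa using hv)
    rw [witnessValue_deterministicMix] at h
    simpa using h

/-- Strong duality, with attainment on both sides. -/
theorem exists_isDualFeasible_isDominated [NeZero nX] {σ : OpFamily nA nX d}
    (hσ : IsAssemblage σ) : ∃ F, IsDualFeasible F ∧ IsDominated σ (witnessValue F σ) := by
  obtain ⟨F, hF, hmax⟩ := exists_isMaxOn_isDualFeasible σ
  refine ⟨F, hF, ?_⟩
  have hv1 : 1 ≤ witnessValue F σ := by
    obtain ⟨F₀, hF₀, h⟩ := exists_isDualFeasible_witnessValue_eq_one hσ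
    exact h ▸ hmax F₀ hF₀
  have hv0 : 0 < witnessValue F σ := by linarith
  by_contra hno
  -- Weak duality excludes domination with weight below the optimum, so only the optimal weight
  -- itself has to be ruled out.
  obtain ⟨G, u, hG, hu, huσ, hGH⟩ := exists_separating_witness σ hσ.1 hv0.le fun c hc hdom => by
    obtain rfl := le_antisymm hc (hF.witnessValue_le hdom)
    exact hno hdom
  -- `G` stays below `u` on models of weight `v = witnessValue F σ`, so `(v / u) • G` stays below
  -- `1` on normalised ones; yet its value on `σ` exceeds `v`, since that of `G` exceeds `u`.
  have hfeas : IsDualFeasible ((witnessValue F σ / u) • G) := by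
    refine isDualFeasible_of_forall_le (fun a x => posSemidef_real_smul (hG a x) (by positivity))
      fun s B hB hB1 => ?_
    have h := hGH (Pi.single s (witnessValue F σ • B))
      (posSemidef_piSingle (posSemidef_real_smul hB hv0.le) s) (by simp [hB1])
    rw [witnessValue_deterministicMix_single, Matrix.mul_smul, Matrix.trace_smul, Complex.smul_re,
      smul_eq_mul] at h
    rw [smul_witnessValue, witnessValue_deterministicMix_single, div_mul_eq_mul_div, div_le_one hu]
    exact h.le
  have h := hmax _ hfeas
  rw [smul_witnessValue, div_mul_eq_mul_div, div_le_iff₀ hu] at h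
  exact absurd (le_of_mul_le_mul_left h hv0) (not_le.2 huσ)

end Duality

/-! ### Robustness and fraction -/

section Robustness

variable {nA nX d : ℕ}

theorem IsDominated.one_le [NeZero nX] {σ : OpFamily nA nX d} (hσ : IsAssemblage σ) {c : ℝ}
    (h : IsDominated σ c) : 1 ≤ c := by
  obtain ⟨F, hF, h1⟩ := exists_isDualFeasible_witnessValue_eq_one hσ
  exact h1 ▸ hF.witnessValue_le h

/-- Multiplying the unsteerable mixture by `1 + t` gives a model exceeding `σ` by `t τ ≥ 0`. -/
theorem isDominated_of_mem_robustnessSet {σ : OpFamily nA nX d} {t : ℝ}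
    (ht : t ∈ robustnessSet σ) : IsDominated σ (1 + t) := by
  obtain ⟨ht0, τ, hτ, hu⟩ := ht
  obtain ⟨H, hH, hH1, hmix⟩ := hu.exists_eq_deterministicMix
  have h0 : (0 : ℝ) < 1 + t := by linarith
  refine ⟨fun s => (1 + t) • H s, fun s => posSemidef_real_smul (hH s) h0.le, fun a x => ?_, ?_⟩
  · have h := congrFun (congrFun hmix a) x
    rw [deterministicMix_smul, ← h, smul_smul, mul_inv_cancel₀ h0.ne', one_smul,
      add_sub_cancel_left]
    exact posSemidef_real_smul (hτ.1 a x) ht0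
  · rw [← Finset.smul_sum, Matrix.trace_smul, Complex.smul_re, hH1, smul_eq_mul, mul_one]

theorem isUnsteerable_smul_deterministicMix {H : (Fin nX → Fin nA) → Matrix (Fin d) (Fin d) ℂ}
    (hH : ∀ s, (H s).PosSemidef) {c : ℝ} (hc : 0 < c) (hHc : (∑ s, H s).trace.re = c) :
    IsUnsteerable (fun a x => c⁻¹ • deterministicMix H a x) := by
  simp only [← deterministicMix_smul]
  refine isUnsteerable_deterministicMix
    (fun s => posSemidef_real_smul (hH s) (inv_nonneg.2 hc.le)) ?_
  rw [← Finset.smul_sum, Matrix.trace_smul, Complex.smul_re, hHc, smul_eq_mul,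
    inv_mul_cancel₀ hc.ne']

/-- The excess of the dominating model over `σ`, divided by its trace `t`, is the noise. Both
marginals are independent of the setting, hence so is that of the excess. -/
theorem mem_robustnessSet_of_isDominated [NeZero nX] {σ : OpFamily nA nX d} (hσ : IsAssemblage σ) {t : ℝ}
    (ht : 0 ≤ t) (h : IsDominated σ (1 + t)) : t ∈ robustnessSet σ := by
  obtain ⟨H, hH, hle, hHt⟩ := h
  obtain ⟨hpos, ρ, hρ, hsum⟩ := hσ
  have hu := isUnsteerable_smul_deterministicMix hH (by linarith) hHt
  have hHsum : (∑ s, H s).PosSemidef := Matrix.posSemidef_sum _ fun s _ => hH s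
  have hdiff : ∀ x, ∑ a, (deterministicMix H a x - σ a x) = ∑ s, H s - ρ := fun x => by
    rw [Finset.sum_sub_distrib, sum_deterministicMix, hsum]
  have htr : (∑ s, H s - ρ).trace = t := by
    rw [Matrix.trace_sub, hρ.2, ← ofReal_re_trace_of_posSemidef hHsum, hHt]
    push_cast
    ring
  rcases ht.eq_or_lt with rfl | ht
  -- For `t = 0` the noise is irrelevant and `σ` fills its place. The excess is positive with total
  -- trace zero for each setting, so it vanishes and `σ` equals the model.
  · refine ⟨le_rfl, σ, ⟨hpos, ρ, hρ, hsum⟩, ?_⟩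
    convert hu using 4 with a x
    rw [zero_smul, add_zero, eq_comm, ← sub_eq_zero, ← (hle a x).trace_eq_zero_iff]
    have h0 : ∑ a, (deterministicMix H a x - σ a x).trace = 0 := by
      rw [← Matrix.trace_sum, hdiff, htr, Complex.ofReal_zero]
    exact (Finset.sum_eq_zero_iff_of_nonneg fun a _ => (hle a x).trace_nonneg).1 h0 a
      (Finset.mem_univ a)
  · refine ⟨ht.le, fun a x => t⁻¹ • (deterministicMix H a x - σ a x),
      ⟨fun a x => posSemidef_real_smul (hle a x) (inv_nonneg.2 ht.le), t⁻¹ • (∑ s, H s - ρ),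
        ⟨?_, ?_⟩, fun x => ?_⟩, ?_⟩
    · rw [← hdiff 0]
      exact posSemidef_real_smul (Matrix.posSemidef_sum _ fun a _ => hle a 0) (inv_nonneg.2 ht.le)
    · rw [Matrix.trace_smul, htr, Complex.real_smul, ← Complex.ofReal_mul, inv_mul_cancel₀ ht.ne',
        Complex.ofReal_one]
    · rw [← Finset.smul_sum, hdiff]
    · convert hu using 4 with a x
      rw [smul_smul, mul_inv_cancel₀ ht.ne', one_smul, add_sub_cancel]

theorem isLeast_robustnessSet [NeZero nX] {σ : OpFamily nA nX d} (hσ : IsAssemblage σ)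
    {F : OpFamily nA nX d} (hF : IsDualFeasible F) (hdom : IsDominated σ (witnessValue F σ)) :
    IsLeast (robustnessSet σ) (witnessValue F σ - 1) := by
  refine ⟨mem_robustnessSet_of_isDominated hσ (sub_nonneg.2 (hdom.one_le hσ))
    (by rwa [add_sub_cancel]), fun t ht => ?_⟩
  have h := hF.witnessValue_le (isDominated_of_mem_robustnessSet ht)
  linarith

theorem isGreatest_robustnessDualValues {σ F : OpFamily nA nX d} (hF : IsDualFeasible F)
    (hdom : IsDominated σ (witnessValue F σ)) :
    IsGreatest (robustnessDualValues σ) (witnessValue F σ) := by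
  refine ⟨mem_robustnessDualValues_iff.2 ⟨F, hF, rfl⟩, fun r hr => ?_⟩
  obtain ⟨G, hG, rfl⟩ := mem_robustnessDualValues_iff.1 hr
  exact hG.witnessValue_le hdom

/-- LHS is empty when `d = 0` or when there are no outcomes; the existence of an assemblage excludes
both. The normalised dominating model is then a member. -/
theorem IsAssemblage.exists_isUnsteerable [NeZero nX] {σ : OpFamily nA nX d}
    (hσ : IsAssemblage σ) : ∃ τ : OpFamily nA nX d, IsUnsteerable τ := by
  obtain ⟨F, hF, hdom⟩ := exists_isDualFeasible_isDominated hσ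
  have h1 := hdom.one_le hσ
  obtain ⟨H, hH, -, hHc⟩ := hdom
  exact ⟨_, isUnsteerable_smul_deterministicMix hH (by linarith) hHc⟩

/-- The values are the continuous image of the compact set of families `H` of total trace one. -/
theorem isGreatest_lhsValues {F τ : OpFamily nA nX d} (hτ : IsUnsteerable τ) :
    IsGreatest (lhsValues F) (lhsBound F) := by
  have hset : lhsValues F = (fun H => ∑ s, (strategySum F s * H s).trace.re) ''
      {H : (Fin nX → Fin nA) → Matrix (Fin d) (Fin d) ℂ |
        (∀ s, (H s).PosSemidef) ∧ (∑ s, H s).trace.re ∈ Set.Icc 1 1} := by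
    ext r
    simp only [lhsValues, Set.mem_ofPred_eq, Set.mem_image, Set.Icc_self, Set.mem_singleton_iff]
    constructor
    · rintro ⟨τ, hτ, rfl⟩
      obtain ⟨H, hH, hH1, rfl⟩ := hτ.exists_eq_deterministicMix
      exact ⟨H, ⟨hH, hH1⟩, (witnessValue_deterministicMix F H).symm⟩
    · rintro ⟨H, ⟨hH, hH1⟩, rfl⟩
      exact ⟨_, isUnsteerable_deterministicMix hH hH1, (witnessValue_deterministicMix F H).symm⟩
  have hcont : Continuous fun H : (Fin nX → Fin nA) → Matrix (Fin d) (Fin d) ℂ =>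
      ∑ s, (strategySum F s * H s).trace.re := by fun_prop
  have hne : (lhsValues F).Nonempty := ⟨_, τ, hτ, rfl⟩
  have hcpt : IsCompact (lhsValues F) := by
    rw [hset]
    exact (isCompact_posSemidef_trace_mem_Icc 1 1).image hcont
  exact hcpt.isGreatest_sSup hne

theorem witnessValue_le_lhsBound {F τ : OpFamily nA nX d} (hτ : IsUnsteerable τ) :
    witnessValue F τ ≤ lhsBound F :=
  (isGreatest_lhsValues hτ).2 ⟨τ, hτ, rfl⟩

theorem isDualFeasible_inv_lhsBound_smul {F : OpFamily nA nX d}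
    (hF : ∀ a x, (F a x).PosSemidef) (h : 0 < lhsBound F) :
    IsDualFeasible ((lhsBound F)⁻¹ • F) := by
  refine isDualFeasible_of_forall_le
    (fun a x => posSemidef_real_smul (hF a x) (inv_nonneg.2 h.le)) fun s B hB hB1 => ?_
  rw [smul_witnessValue, inv_mul_le_iff₀ h, mul_one]
  exact witnessValue_le_lhsBound (isUnsteerable_deterministicMix (posSemidef_piSingle hB s)
    (by simpa using hB1))

theorem isGreatest_fractionRatios [NeZero nX] {σ : OpFamily nA nX d} (hσ : IsAssemblage σ)
    {F : OpFamily nA nX d} (hF : IsDualFeasible F) (hdom : IsDominated σ (witnessValue F σ)) :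
    IsGreatest (fractionRatios σ) (witnessValue F σ) := by
  have hv : 0 < witnessValue F σ := zero_lt_one.trans_le (hdom.one_le hσ)
  constructor
  · obtain ⟨H, hH, hle, hHc⟩ := id hdom
    have hu := isUnsteerable_smul_deterministicMix hH hv hHc
    have hb : lhsBound F = 1 := by
      refine le_antisymm ?_ ?_
      · obtain ⟨τ, hτ, h⟩ := (isGreatest_lhsValues (F := F) hu).1
        obtain ⟨H', hH', hH1, rfl⟩ := hτ.exists_eq_deterministicMix
        exact h.le.trans ((hF.witnessValue_deterministicMix_le hH').trans hH1.le)
      -- The normalised dominating model attains the bound: before normalisation its value is at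
      -- least that of `σ`, which equals its weight.
      · refine le_trans ?_ (witnessValue_le_lhsBound hu)
        have h := witnessValue_le_of_posSemidef_sub hF.1 hle
        have h2 := witnessValue_smul F (deterministicMix H) (witnessValue F σ)⁻¹
        change _ ≤ witnessValue F ((witnessValue F σ)⁻¹ • deterministicMix H)
        rw [h2, le_inv_mul_iff₀ hv, mul_one]
        exact h
    exact ⟨F, hF.1, by rw [hb]; exact zero_lt_one, by rw [hb, div_one]⟩
  · rintro r ⟨G, hG, hb, rfl⟩
    have h := (isDualFeasible_inv_lhsBound_smul hG hb).witnessValue_le hdom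
    rwa [smul_witnessValue, inv_mul_eq_div] at h

end Robustness

/-! ### The measurement-device-independent measure -/

section MDI

variable {nA nX d : ℕ}

/-- The witness on Bob's side induced by the game `β` and Bob's effect `E`. -/
noncomputable def gameWitness (ω : QuestionSet d) (E : Matrix (Fin d × Fin d) (Fin d × Fin d) ℂ)
    (β : Fin nA → Fin nX → Fin ω.card → ℝ) : OpFamily nA nX d :=
  fun a x => partialTraceMul E (∑ y, β a x y • ω.state y)

theorem payoff_stat (ω : QuestionSet d) (E : Matrix (Fin d × Fin d) (Fin d × Fin d) ℂ)
    (β : Fin nA → Fin nX → Fin ω.card → ℝ) (σ : OpFamily nA nX d) :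
    payoff (stat ω E σ) β = witnessValue (gameWitness ω E β) σ := by
  simp only [payoff, stat, witnessValue_eq_sum, gameWitness, partialTraceMul_sum_smul,
    trace_mul_kronecker, Finset.sum_mul, Matrix.trace_sum, Complex.re_sum, Matrix.smul_mul,
    Matrix.trace_smul, Complex.smul_re, smul_eq_mul]

theorem lhsPayoffs_eq (ω : QuestionSet d) (E : Matrix (Fin d × Fin d) (Fin d × Fin d) ℂ)
    (β : Fin nA → Fin nX → Fin ω.card → ℝ) :
    lhsPayoffs ω E β = lhsValues (gameWitness ω E β) := by
  simp only [lhsPayoffs, lhsValues, payoff_stat]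

theorem lhsPayoff_eq (ω : QuestionSet d) (E : Matrix (Fin d × Fin d) (Fin d × Fin d) ℂ)
    (β : Fin nA → Fin nX → Fin ω.card → ℝ) :
    lhsPayoff ω E β = lhsBound (gameWitness ω E β) := by
  rw [lhsPayoff, lhsPayoffs_eq, lhsBound]

theorem posSemidef_gameWitness {ω : QuestionSet d}
    {E : Matrix (Fin d × Fin d) (Fin d × Fin d) ℂ} {β : Fin nA → Fin nX → Fin ω.card → ℝ}
    (hβ : IsGame ω β) (hE : IsEffect E) (a : Fin nA) (x : Fin nX) :
    (gameWitness ω E β a x).PosSemidef := by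
  refine posSemidef_partialTraceMul hE.1 ?_
  have h := (hβ a x).transpose
  simpa only [Matrix.transpose_sum, Matrix.transpose_smul, Matrix.transpose_transpose] using h

/-- The projection onto the maximally entangled state. -/
noncomputable def maxEntangled (d : ℕ) : Matrix (Fin d × Fin d) (Fin d × Fin d) ℂ :=
  Matrix.of fun i j => if i.1 = i.2 ∧ j.1 = j.2 then (d : ℂ)⁻¹ else 0

/-- A Hermitian idempotent and its complement both have the form `Xᴴ X`. -/
theorem isEffect_maxEntangled (d : ℕ) : IsEffect (maxEntangled d) := by
  have hH : (maxEntangled d).IsHermitian := by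
    ext i j
    simp only [maxEntangled, Matrix.conjTranspose_apply, Matrix.of_apply, and_comm]
    split_ifs <;> simp
  have hsq : maxEntangled d * maxEntangled d = maxEntangled d := by
    ext i j
    rcases Nat.eq_zero_or_pos d with rfl | hd
    · exact i.1.elim0
    have hd' : (d : ℂ) ≠ 0 := by exact_mod_cast hd.ne'
    simp only [maxEntangled, Matrix.mul_apply, Matrix.of_apply, Fintype.sum_prod_type]
    by_cases hi : i.1 = i.2 <;> by_cases hj : j.1 = j.2 <;> simp [hi, hj, hd']
  constructor
  · rw [← hsq]
    nth_rw 1 [← hH.eq]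
    exact Matrix.posSemidef_conjTranspose_mul_self _
  · have h : 1 - maxEntangled d = (1 - maxEntangled d)ᴴ * (1 - maxEntangled d) := by
      rw [Matrix.conjTranspose_sub, Matrix.conjTranspose_one, hH.eq, sub_mul, mul_sub, mul_sub,
        hsq]
      simp
    rw [h]
    exact Matrix.posSemidef_conjTranspose_mul_self _

theorem partialTraceMul_maxEntangled (ω : Matrix (Fin d) (Fin d) ℂ) :
    partialTraceMul (maxEntangled d) ω = (d : ℝ)⁻¹ • ωᵀ := by
  ext i j
  simp only [partialTraceMul, maxEntangled, Matrix.of_apply, ite_mul, zero_mul, Matrix.smul_apply,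
    Matrix.transpose_apply, ite_and]
  simp

/-- Payoffs are witness values of the induced witness, LHS bounds included, so it only matters which
witnesses arise. All induced ones are positive; conversely each positive `F` with positive local
bound is induced. -/
theorem mdiRatios_eq_fractionRatios (ω : QuestionSet d) (σ : OpFamily nA nX d) :
    mdiRatios ω σ = fractionRatios σ := by
  ext r
  constructor
  · rintro ⟨β, E, hβ, hE, hpos, rfl⟩
    rw [lhsPayoff_eq] at hpos
    exact ⟨gameWitness ω E β, posSemidef_gameWitness hβ hE, hpos, by
      rw [payoff_stat, lhsPayoff_eq]⟩
  · rintro ⟨F, hF, hpos, rfl⟩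
    have hd : (d : ℝ) ≠ 0 := by
      -- In dimension zero every witness value is `0`, so the local bound is `0` whether or not LHS
      -- is empty, against `hpos`.
      rintro h
      obtain rfl : d = 0 := by exact_mod_cast h
      refine hpos.ne' ?_
      have h0 : ∀ τ : OpFamily nA nX 0, witnessValue F τ = 0 := fun τ => by
        simp [witnessValue_eq_sum, Matrix.trace]
      have hsub : lhsValues F ⊆ {0} := by
        rintro _ ⟨τ, -, rfl⟩
        exact h0 τ
      rcases Set.subset_singleton_iff_eq.1 hsub with h | h <;> simp [lhsBound, h]
    -- The maximally entangled projection transposes and divides by `d`, so the questions have to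
    -- combine to `d Fᵀ`.
    choose β hβ using fun a x => ω.complete ((d : ℝ) • (F a x)ᵀ)
      (posSemidef_real_smul (hF a x).transpose d.cast_nonneg).isHermitian
    have hw : gameWitness ω (maxEntangled d) β = F := by
      funext a x
      rw [gameWitness, ← hβ, partialTraceMul_maxEntangled, Matrix.transpose_smul,
        Matrix.transpose_transpose, smul_smul, inv_mul_cancel₀ hd, one_smul]
    refine ⟨β, maxEntangled d, fun a x => ?_, isEffect_maxEntangled d, ?_, ?_⟩
    · simp only [← Matrix.transpose_smul, ← Matrix.transpose_sum, ← hβ]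
      exact (posSemidef_real_smul (hF a x).transpose d.cast_nonneg).transpose
    · rwa [lhsPayoff_eq, hw]
    · rw [payoff_stat, lhsPayoff_eq, hw]

end MDI

/-! ### Monotonicity -/

section Monotone

variable {nA nX d nA' nX' d' : ℕ}

theorem mdiMeasure_eq_witnessValue_sub_one [NeZero nX] (ω : QuestionSet d)
    {σ : OpFamily nA nX d} (hσ : IsAssemblage σ) {F : OpFamily nA nX d} (hF : IsDualFeasible F)
    (hdom : IsDominated σ (witnessValue F σ)) : mdiMeasure ω σ = witnessValue F σ - 1 := by
  rw [mdiMeasure, mdiRatios_eq_fractionRatios, (isGreatest_fractionRatios hσ hF hdom).csSup_eq,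
    max_eq_left (sub_nonneg.2 (hdom.one_le hσ))]

theorem isDominated_mdiMeasure_add_one [NeZero nX] (ω : QuestionSet d) {σ : OpFamily nA nX d}
    (hσ : IsAssemblage σ) : IsDominated σ (mdiMeasure ω σ + 1) := by
  obtain ⟨F, hF, hdom⟩ := exists_isDualFeasible_isDominated hσ
  rwa [mdiMeasure_eq_witnessValue_sub_one ω hσ hF hdom, sub_add_cancel]

/-- With `isDominated_mdiMeasure_add_one`, this identifies the measure plus one with the least
dominating weight. Upper bounds on the measure thus only require a dominating model. -/
theorem mdiMeasure_le_of_isDominated [NeZero nX] (ω : QuestionSet d) {σ : OpFamily nA nX d}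
    (hσ : IsAssemblage σ) {c : ℝ} (h : IsDominated σ c) : mdiMeasure ω σ ≤ c - 1 := by
  obtain ⟨F, hF, hdom⟩ := exists_isDualFeasible_isDominated hσ
  rw [mdiMeasure_eq_witnessValue_sub_one ω hσ hF hdom]
  exact sub_le_sub_right (hF.witnessValue_le h) 1

theorem IsUnsteerable.isDominated_one {σ : OpFamily nA nX d} (hσ : IsUnsteerable σ) :
    IsDominated σ 1 := by
  obtain ⟨H, hH, hH1, rfl⟩ := hσ.exists_eq_deterministicMix
  exact ⟨H, hH, fun a x => by simpa using Matrix.PosSemidef.zero, hH1⟩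

theorem IsDominated.smul {σ : OpFamily nA nX d} {c p : ℝ} (h : IsDominated σ c) (hp : 0 ≤ p) :
    IsDominated (fun a x => p • σ a x) (p * c) := by
  obtain ⟨H, hH, hle, rfl⟩ := h
  refine ⟨fun s => p • H s, fun s => posSemidef_real_smul (hH s) hp, fun a x => ?_, ?_⟩
  · rw [deterministicMix_smul, ← smul_sub]
    exact posSemidef_real_smul (hle a x) hp
  · rw [← Finset.smul_sum, Matrix.trace_smul, Complex.smul_re, smul_eq_mul]

theorem IsDominated.add {σ σ' : OpFamily nA nX d} {c c' : ℝ} (h : IsDominated σ c)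
    (h' : IsDominated σ' c') : IsDominated (fun a x => σ a x + σ' a x) (c + c') := by
  obtain ⟨H, hH, hle, rfl⟩ := h
  obtain ⟨H', hH', hle', rfl⟩ := h'
  refine ⟨fun s => H s + H' s, fun s => (hH s).add (hH' s), fun a x => ?_, ?_⟩
  · have hmix : deterministicMix (fun s => H s + H' s) a x
        = deterministicMix H a x + deterministicMix H' a x := by
      simp only [deterministicMix, ← Finset.sum_add_distrib]
      exact Finset.sum_congr rfl fun s _ => by split_ifs <;> simp
    rw [hmix, add_sub_add_comm]
    exact (hle a x).add (hle' a x)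
  · rw [Finset.sum_add_distrib, Matrix.trace_add, Complex.add_re]

theorem IsAssemblage.convexCombination {σ σ' : OpFamily nA nX d} (hσ : IsAssemblage σ)
    (hσ' : IsAssemblage σ') {μ : ℝ} (h0 : 0 ≤ μ) (h1 : μ ≤ 1) :
    IsAssemblage fun a x => μ • σ a x + (1 - μ) • σ' a x := by
  obtain ⟨hpos, ρ, hρ, hsum⟩ := hσ
  obtain ⟨hpos', ρ', hρ', hsum'⟩ := hσ'
  have h1' : 0 ≤ 1 - μ := sub_nonneg.2 h1
  refine ⟨fun a x => (posSemidef_real_smul (hpos a x) h0).add (posSemidef_real_smul (hpos' a x) h1'),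
    μ • ρ + (1 - μ) • ρ', ⟨(posSemidef_real_smul hρ.1 h0).add (posSemidef_real_smul hρ'.1 h1'), ?_⟩,
    fun x => ?_⟩
  · rw [Matrix.trace_add, Matrix.trace_smul, Matrix.trace_smul, hρ.2, hρ'.2, ← add_smul]
    simp
  · rw [Finset.sum_add_distrib, ← Finset.smul_sum, ← Finset.smul_sum, hsum, hsum']

theorem OneWayLOCC.posSemidef_branch (M : OneWayLOCC nA nX d nA' nX' d') (w : Fin M.card)
    {σ : OpFamily nA nX d} (hσ : ∀ a x, (σ a x).PosSemidef) (a' : Fin nA') (x' : Fin nX') :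
    (M.branch w σ a' x').PosSemidef :=
  (Matrix.posSemidef_sum _ fun a _ => Matrix.posSemidef_sum _ fun x _ =>
    posSemidef_real_smul (hσ a x) (mul_nonneg ((M.inProb_isProb w x').1 x)
      ((M.outProb_isProb w x' x a).1 a'))).mul_mul_conjTranspose_same _

theorem OneWayLOCC.branch_sub (M : OneWayLOCC nA nX d nA' nX' d') (w : Fin M.card)
    (σ τ : OpFamily nA nX d) (a' : Fin nA') (x' : Fin nX') :
    M.branch w (σ - τ) a' x' = M.branch w σ a' x' - M.branch w τ a' x' := by
  simp only [OneWayLOCC.branch, Pi.sub_apply, smul_sub, Finset.sum_sub_distrib, Matrix.mul_sub,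
    Matrix.sub_mul]

theorem OneWayLOCC.sum_branch (M : OneWayLOCC nA nX d nA' nX' d') (w : Fin M.card)
    {σ : OpFamily nA nX d} {ρ : Matrix (Fin d) (Fin d) ℂ} (hσ : ∀ x, ∑ a, σ a x = ρ)
    (x' : Fin nX') : ∑ a', M.branch w σ a' x' = M.kraus w * ρ * (M.kraus w)ᴴ := by
  simp only [OneWayLOCC.branch]
  rw [← Matrix.sum_mul, ← Matrix.mul_sum]
  congr 2
  calc ∑ a', ∑ a, ∑ x, (M.inProb w x' x * M.outProb w x' x a a') • σ a x
      = ∑ a, ∑ x, ∑ a', (M.inProb w x' x * M.outProb w x' x a a') • σ a x := by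
        rw [Finset.sum_comm]
        exact Finset.sum_congr rfl fun a _ => Finset.sum_comm
    _ = ∑ a, ∑ x, M.inProb w x' x • σ a x := by
        simp only [← Finset.sum_smul, ← Finset.mul_sum, (M.outProb_isProb w x' _ _).2, mul_one]
    _ = ρ := by
        rw [Finset.sum_comm]
        simp only [← Finset.smul_sum, hσ]
        rw [← Finset.sum_smul, (M.inProb_isProb w x').2, one_smul]

theorem OneWayLOCC.sum_trace_kraus (M : OneWayLOCC nA nX d nA' nX' d')
    (Y : Matrix (Fin d) (Fin d) ℂ) :
    ∑ w, (M.kraus w * Y * (M.kraus w)ᴴ).trace.re = Y.trace.re := by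
  have h : ∀ w, (M.kraus w * Y * (M.kraus w)ᴴ).trace = ((M.kraus w)ᴴ * M.kraus w * Y).trace :=
    fun w => by rw [Matrix.trace_mul_comm, Matrix.mul_assoc]
  rw [← Complex.re_sum, Finset.sum_congr rfl fun w _ => h w, ← Matrix.trace_sum, ← Matrix.sum_mul,
    M.kraus_complete, Matrix.one_mul]

/-- Wiring turns each deterministic strategy into a stochastic response, which splits again into
deterministic ones. The branch map is linear and positive, so it preserves the domination. -/
theorem OneWayLOCC.isDominated_branch (M : OneWayLOCC nA nX d nA' nX' d') (w : Fin M.card)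
    {σ : OpFamily nA nX d} {H : (Fin nX → Fin nA) → Matrix (Fin d) (Fin d) ℂ}
    (hH : ∀ s, (H s).PosSemidef) (hle : ∀ a x, (deterministicMix H a x - σ a x).PosSemidef) :
    IsDominated (M.branch w σ) (M.kraus w * (∑ s, H s) * (M.kraus w)ᴴ).trace.re := by
  obtain ⟨H', hH', hsum, hmix⟩ := exists_deterministicMix_eq
    (fun (s : Fin nX → Fin nA) (x' : Fin nX') (a' : Fin nA') =>
      ∑ x, M.inProb w x' x * M.outProb w x' x (s x) a')
    (fun s x' => ⟨fun a' => Finset.sum_nonneg fun x _ => mul_nonneg ((M.inProb_isProb w x').1 x)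
      ((M.outProb_isProb w x' x (s x)).1 a'), by
        rw [Finset.sum_comm]
        simp only [← Finset.mul_sum, (M.outProb_isProb w x' _ _).2, mul_one,
          (M.inProb_isProb w x').2]⟩)
    (fun s => M.kraus w * H s * (M.kraus w)ᴴ) fun s => (hH s).mul_mul_conjTranspose_same _
  have hbranch : ∀ a' x', M.branch w (deterministicMix H) a' x' = deterministicMix H' a' x' :=
    fun a' x' => by
      rw [← hmix]
      rw [Finset.sum_congr rfl fun s _ => show _ = M.kraus w * ((∑ x, M.inProb w x' x *
        M.outProb w x' x (s x) a') • H s) * (M.kraus w)ᴴ by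
          rw [Matrix.mul_smul, Matrix.smul_mul]]
      rw [← Matrix.sum_mul, ← Matrix.mul_sum, OneWayLOCC.branch]
      congr 2
      simp only [deterministicMix, Finset.smul_sum, Finset.sum_smul]
      rw [Finset.sum_comm, Finset.sum_comm (s := (Finset.univ : Finset (Fin nX → Fin nA)))]
      refine Finset.sum_congr rfl fun x _ => ?_
      rw [Finset.sum_comm]
      exact Finset.sum_congr rfl fun s _ => by simp
  refine ⟨H', hH', fun a' x' => ?_, ?_⟩
  · rw [← hbranch, ← M.branch_sub]
    exact M.posSemidef_branch w hle a' x'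
  · rw [hsum, ← Matrix.sum_mul, ← Matrix.mul_sum]

theorem OneWayLOCC.isAssemblage_branch (M : OneWayLOCC nA nX d nA' nX' d') (w : Fin M.card)
    {σ : OpFamily nA nX d} (hpos : ∀ a x, (σ a x).PosSemidef) {ρ : Matrix (Fin d) (Fin d) ℂ}
    (hρ : ρ.PosSemidef) (hsum : ∀ x, ∑ a, σ a x = ρ)
    (hP : 0 < (M.kraus w * ρ * (M.kraus w)ᴴ).trace.re) :
    IsAssemblage fun a x => ((M.kraus w * ρ * (M.kraus w)ᴴ).trace.re)⁻¹ • M.branch w σ a x := by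
  have hK := hρ.mul_mul_conjTranspose_same (M.kraus w)
  refine ⟨fun a x => posSemidef_real_smul (M.posSemidef_branch w hpos a x) (inv_nonneg.2 hP.le),
    _, ⟨posSemidef_real_smul hK (inv_nonneg.2 hP.le), ?_⟩, fun x => ?_⟩
  · rw [Matrix.trace_smul]
    nth_rw 2 [← ofReal_re_trace_of_posSemidef hK]
    rw [Complex.real_smul, ← Complex.ofReal_mul, inv_mul_cancel₀ hP.ne', Complex.ofReal_one]
  · rw [← Finset.smul_sum, M.sum_branch w hsum]

/-- An optimal dominating model of `σ` is sent through every branch. Each term is then at most the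
branch weight minus `P(w)`; by completeness of the Kraus operators the weights sum to the measure
plus one, and the probabilities to one. -/
theorem OneWayLOCC.sum_prob_mul_mdiMeasure_le [NeZero nX] [NeZero nX']
    (M : OneWayLOCC nA nX d nA' nX' d') (ω : QuestionSet d) (ω' : QuestionSet d')
    {σ : OpFamily nA nX d} (hσ : IsAssemblage σ) :
    ∑ w, M.prob w σ * mdiMeasure ω' (fun a x => (M.prob w σ)⁻¹ • M.branch w σ a x) ≤
      mdiMeasure ω σ := by
  obtain ⟨H, hH, hle, hHc⟩ := isDominated_mdiMeasure_add_one ω hσ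
  obtain ⟨hpos, ρ, hρ, hsum⟩ := hσ
  have hprob : ∀ w, M.prob w σ = (M.kraus w * ρ * (M.kraus w)ᴴ).trace.re := fun w => by
    rw [OneWayLOCC.prob, reducedState, M.sum_branch w hsum]
  simp only [hprob]
  have hterm : ∀ w, (M.kraus w * ρ * (M.kraus w)ᴴ).trace.re * mdiMeasure ω' (fun a x =>
      ((M.kraus w * ρ * (M.kraus w)ᴴ).trace.re)⁻¹ • M.branch w σ a x) ≤
      (M.kraus w * (∑ s, H s) * (M.kraus w)ᴴ).trace.re
        - (M.kraus w * ρ * (M.kraus w)ᴴ).trace.re := fun w => by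
    -- On a branch of probability zero the normalised family need not be an assemblage, but its term
    -- vanishes and the branch weight is nonnegative.
    rcases (re_trace_nonneg_of_posSemidef
      (hρ.1.mul_mul_conjTranspose_same (M.kraus w))).eq_or_lt with h0 | h0
    · rw [← h0, zero_mul, sub_zero]
      exact re_trace_nonneg_of_posSemidef ((Matrix.posSemidef_sum _ fun s _ =>
        hH s).mul_mul_conjTranspose_same _)
    · have h := mdiMeasure_le_of_isDominated ω' (M.isAssemblage_branch w hpos hρ.1 hsum h0)
        ((M.isDominated_branch w hH hle).smul (inv_nonneg.2 h0.le))
      refine (mul_le_mul_of_nonneg_left h h0.le).trans_eq ?_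
      rw [mul_sub, mul_inv_cancel_left₀ h0.ne', mul_one]
  refine (Finset.sum_le_sum fun w _ => hterm w).trans_eq ?_
  rw [Finset.sum_sub_distrib, M.sum_trace_kraus, M.sum_trace_kraus, hHc, hρ.2, Complex.one_re,
    add_sub_cancel_right]

theorem isConvexSteeringMonotone_mdiMeasure (ω : ∀ _nA _nX d : ℕ, QuestionSet d) :
    IsConvexSteeringMonotone fun nA nX d σ => mdiMeasure (ω nA nX d) σ where
  nonneg _ _ _ _ _ _ := le_max_right _ _
  vanish nA nX d _ σ hσ := by
    have h := mdiMeasure_le_of_isDominated (ω nA nX d) hσ.isAssemblage hσ.isDominated_one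
    exact le_antisymm (h.trans_eq (sub_self 1)) (le_max_right _ _)
  monotone nA nX d nA' nX' d' _ _ M σ hσ :=
    M.sum_prob_mul_mdiMeasure_le (ω nA nX d) (ω nA' nX' d') hσ
  convex nA nX d _ σ σ' hσ hσ' μ h0 h1 := by
    have h := mdiMeasure_le_of_isDominated (ω nA nX d) (hσ.convexCombination hσ' h0 h1)
      (((isDominated_mdiMeasure_add_one (ω nA nX d) hσ).smul h0).add
        ((isDominated_mdiMeasure_add_one (ω nA nX d) hσ').smul (sub_nonneg.2 h1)))
    refine h.trans_eq ?_
    ring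

end Monotone

theorem theorem1 (ω : ∀ _nA _nX d : ℕ, QuestionSet d) :
    (∀ (nA nX d : ℕ) [NeZero nX] (σ : OpFamily nA nX d), IsAssemblage σ →
      -- the equalities
      mdiMeasure (ω nA nX d) σ = steeringFraction σ ∧
      mdiMeasure (ω nA nX d) σ = steeringRobustness σ ∧
      -- the suprema, maxima and minima in the definitions are genuine
      (mdiRatios (ω nA nX d) σ).Nonempty ∧ BddAbove (mdiRatios (ω nA nX d) σ) ∧
      (∀ β E, IsGame (ω nA nX d) β → IsEffect E →
        (lhsPayoffs (nA := nA) (nX := nX) (ω nA nX d) E β).Nonempty ∧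
          BddAbove (lhsPayoffs (nA := nA) (nX := nX) (ω nA nX d) E β)) ∧
      IsGreatest (fractionRatios σ) (steeringFraction σ + 1) ∧
      (∀ F : OpFamily nA nX d, (∀ a x, (F a x).PosSemidef) →
        IsGreatest (lhsValues F) (lhsBound F)) ∧
      IsLeast (robustnessSet σ) (steeringRobustness σ) ∧
      IsGreatest (robustnessDualValues σ) (steeringRobustness σ + 1)) ∧
    -- the measure is a convex steering monotone
    IsConvexSteeringMonotone (fun nA nX d σ => mdiMeasure (ω nA nX d) σ) := by

  refine ⟨fun nA nX d _ σ hσ => ?_, isConvexSteeringMonotone_mdiMeasure ω⟩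
  obtain ⟨F, hF, hdom⟩ := exists_isDualFeasible_isDominated hσ
  obtain ⟨τ, hτ⟩ := hσ.exists_isUnsteerable
  have hmdi := mdiMeasure_eq_witnessValue_sub_one (ω nA nX d) hσ hF hdom
  have hfrac := isGreatest_fractionRatios hσ hF hdom
  have hfrac_eq : steeringFraction σ = witnessValue F σ - 1 := by
    rw [steeringFraction, hfrac.csSup_eq]
  have hrob := isLeast_robustnessSet hσ hF hdom
  have hrob_eq : steeringRobustness σ = witnessValue F σ - 1 := hrob.csInf_eq
  -- All three quantities become the optimal dual value minus one.
  rw [mdiRatios_eq_fractionRatios, hmdi, hfrac_eq, hrob_eq, sub_add_cancel]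
  refine ⟨rfl, rfl, ⟨_, hfrac.1⟩, ⟨_, hfrac.2⟩, fun β E _ _ => ?_, hfrac,
    fun G _ => isGreatest_lhsValues hτ, hrob, isGreatest_robustnessDualValues hF hdom⟩
  rw [lhsPayoffs_eq]
  have h := isGreatest_lhsValues (F := gameWitness (ω nA nX d) E β) hτ
  exact ⟨⟨_, h.1⟩, ⟨_, h.2⟩⟩
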